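/- Let $a\ge 0$, $b>0$, $N\in\{2,3\}$, and let $f:\mathbb R\to\mathbb R$, with $F(t):=\int_0^t f(\tau)\,d\tau$, satisfy: - (f1) $f$ is continuous and odd; - (f2) $-\infty<\liminf_{t\to0} f(t)/t\le\limsup_{t\to0} f(t)/t<0$; - (f3) if $N=3$, then $\lim_{t\to\infty} f(t)/|t|^{5}=0$; if $N=2$, then $\lim_{t\to\infty} f(t)/e^{\alpha t^2}=0$ for every $\alpha>0$; - (f4) there is $\zeta>0$ with $F(\zeta)>0$. Let $H^1_r(\mathbb R^N)$ be the space of radial functions in $H^1(\mathbb R^N)$, with the $H^1$-norm, and let $$\Phi(u)=\frac a2\int_{\mathbb R^N}|\nabla u|^2+\frac b4\Big(\int_{\mathbb R^N}|\nabla u|^2\Big)^2-\int_{\mathbb R^N}F(u).$$ Then $O_r:=\{u\in H^1_r(\mathbb R^N) : \Phi(u)<0\}$ is nonempty and arc-wise connected, that is, for any $u_1,u_2\in O_r$ there is a continuous path in $O_r$ joining $u_1$ and $u_2$. -/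

import Mathlib

open MeasureTheory Filter Topology
open scoped ContDiff ENNReal

noncomputable section

namespace Kirchhoff

/-- The Euclidean space `ℝ^N`, with the Euclidean norm and the Lebesgue measure. -/
abbrev Space (N : ℕ) : Type := EuclideanSpace ℝ (Fin N)

/-- `L²(ℝ^N)`. -/
abbrev L2 (N : ℕ) : Type := Lp ℝ 2 (volume : Measure (Space N))

/-- `L²(ℝ^N; ℝ^N)`. -/
abbrev L2Vec (N : ℕ) : Type := Lp (Space N) 2 (volume : Measure (Space N))

/-- `g` is the weak gradient of `u` on `ℝ^N`:
`∫ u ∂_v φ = - ∫ φ (g · v)` for every `φ ∈ C_c^∞(ℝ^N)` and every direction `v`. -/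
def HasWeakGradient {N : ℕ} (u : Space N → ℝ) (g : Space N → Space N) : Prop :=
  ∀ φ : Space N → ℝ, ContDiff ℝ ∞ φ → HasCompactSupport φ → ∀ v : Space N,
    ∫ x, u x * fderiv ℝ φ x v = - ∫ x, φ x * inner ℝ (g x) v

lemma integrable_mul_fderiv {N : ℕ} (u : L2 N) {φ : Space N → ℝ} (hφ : ContDiff ℝ ∞ φ)
    (hc : HasCompactSupport φ) (v : Space N) :
    Integrable (fun x => u x * fderiv ℝ φ x v) := by
  have h1 : Continuous (fun x => fderiv ℝ φ x v) :=
    (hφ.continuous_fderiv (by simp)).clm_apply continuous_const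
  have h2 : HasCompactSupport (fun x => fderiv ℝ φ x v) := hc.fderiv_apply ℝ v
  exact (Lp.memLp u).integrable_mul (h1.memLp_of_hasCompactSupport (p := 2) h2)

lemma integrable_mul_inner {N : ℕ} (g : L2Vec N) {φ : Space N → ℝ} (hφ : ContDiff ℝ ∞ φ)
    (hc : HasCompactSupport φ) (v : Space N) :
    Integrable (fun x => φ x * inner ℝ (g x) v) :=
  (hφ.continuous.memLp_of_hasCompactSupport (p := 2) hc).integrable_mul
    ((Lp.memLp g).inner_const v)

/-- The Sobolev space `H¹(ℝ^N)`: the pairs `(u, ∇u)` with `u ∈ L²` and weak gradient `∇u ∈ L²`.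
The second component is determined by the first one, see `H1_ext`. The norm is the one induced
by the `ℓ²`-product, that is `‖u‖² = ∫ u² + ∫ |∇u|²`. -/
def H1 (N : ℕ) : Submodule ℝ (WithLp 2 (L2 N × L2Vec N)) where
  carrier := {p | HasWeakGradient p.fst p.snd}
  zero_mem' := by
    intro φ _ _ v
    have h1 : (fun x => ((0 : WithLp 2 (L2 N × L2Vec N)).fst : Space N → ℝ) x * fderiv ℝ φ x v)
        =ᵐ[volume] fun _ => 0 := by
      filter_upwards [Lp.coeFn_zero ℝ 2 (volume : Measure (Space N))] with x hx
      rw [WithLp.zero_fst, hx]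
      simp
    have h2 : (fun x => φ x *
        inner ℝ (((0 : WithLp 2 (L2 N × L2Vec N)).snd : Space N → Space N) x) v)
        =ᵐ[volume] fun _ => 0 := by
      filter_upwards [Lp.coeFn_zero (Space N) 2 (volume : Measure (Space N))] with x hx
      rw [WithLp.zero_snd, hx]
      simp
    rw [integral_congr_ae h1, integral_congr_ae h2]
    simp
  add_mem' := by
    intro p q hp hq φ hφ hc v
    have h1 : (fun x => ((p + q).fst : Space N → ℝ) x * fderiv ℝ φ x v)
        =ᵐ[volume] fun x => p.fst x * fderiv ℝ φ x v + q.fst x * fderiv ℝ φ x v := by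
      filter_upwards [Lp.coeFn_add p.fst q.fst] with x hx
      rw [WithLp.add_fst, hx, Pi.add_apply, add_mul]
    have h2 : (fun x => φ x * inner ℝ (((p + q).snd : Space N → Space N) x) v)
        =ᵐ[volume] fun x => φ x * inner ℝ (p.snd x) v + φ x * inner ℝ (q.snd x) v := by
      filter_upwards [Lp.coeFn_add p.snd q.snd] with x hx
      rw [WithLp.add_snd, hx, Pi.add_apply, inner_add_left, mul_add]
    rw [integral_congr_ae h1, integral_congr_ae h2,
      integral_add (integrable_mul_fderiv _ hφ hc v) (integrable_mul_fderiv _ hφ hc v),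
      integral_add (integrable_mul_inner _ hφ hc v) (integrable_mul_inner _ hφ hc v),
      hp φ hφ hc v, hq φ hφ hc v]
    ring
  smul_mem' := by
    intro c p hp φ hφ hc v
    have h1 : (fun x => ((c • p).fst : Space N → ℝ) x * fderiv ℝ φ x v)
        =ᵐ[volume] fun x => c * (p.fst x * fderiv ℝ φ x v) := by
      filter_upwards [Lp.coeFn_smul c p.fst] with x hx
      simp [hx, mul_assoc]
    have h2 : (fun x => φ x * inner ℝ (((c • p).snd : Space N → Space N) x) v)
        =ᵐ[volume] fun x => c * (φ x * inner ℝ (p.snd x) v) := by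
      filter_upwards [Lp.coeFn_smul c p.snd] with x hx
      simp only [WithLp.smul_snd, hx, Pi.smul_apply, real_inner_smul_left]
      ring
    rw [integral_congr_ae h1, integral_congr_ae h2, integral_const_mul, integral_const_mul,
      hp φ hφ hc v]
    ring

/-- The underlying `L²` function of `u ∈ H¹(ℝ^N)`. -/
def fn {N : ℕ} (u : H1 N) : L2 N := (u : WithLp 2 (L2 N × L2Vec N)).fst

/-- The weak gradient of `u ∈ H¹(ℝ^N)`. -/
def weakGrad {N : ℕ} (u : H1 N) : L2Vec N := (u : WithLp 2 (L2 N × L2Vec N)).snd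

/-- An element of `H¹(ℝ^N)` is determined by its underlying function. -/
theorem H1_ext {N : ℕ} {u w : H1 N} (h : fn u = fn w) : u = w := by
  have key : ∀ v : Space N, ∀ᵐ x, inner ℝ (weakGrad u x) v = inner ℝ (weakGrad w x) v := by
    intro v
    have hl : ∀ g : L2Vec N, LocallyIntegrable (fun x => inner ℝ (g x) v) := fun g =>
      ((Lp.memLp g).inner_const v).locallyIntegrable (by norm_num)
    refine ae_eq_of_integral_contDiff_smul_eq (hl _) (hl _) fun φ hφ hc => ?_
    have e1 := u.2 φ hφ hc v
    have e2 := w.2 φ hφ hc v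
    have e3 : (u : WithLp 2 (L2 N × L2Vec N)).fst = (w : WithLp 2 (L2 N × L2Vec N)).fst := h
    rw [e3, e2] at e1
    simpa [weakGrad] using e1.symm
  have hg : weakGrad u = weakGrad w := by
    refine Lp.ext ?_
    have hall : ∀ᵐ x, ∀ i : Fin N, inner ℝ (weakGrad u x) (EuclideanSpace.single i (1 : ℝ))
        = inner ℝ (weakGrad w x) (EuclideanSpace.single i (1 : ℝ)) := ae_all_iff.2 fun i => key _
    filter_upwards [hall] with x hx
    ext i
    simpa [EuclideanSpace.inner_single_right] using hx i
  exact Subtype.ext (WithLp.ofLp_injective 2 (Prod.ext h hg))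

/-- The norm of `H¹(ℝ^N)` is the standard one. -/
theorem H1_norm_sq_eq {N : ℕ} (u : H1 N) : ‖u‖ ^ 2 = ‖fn u‖ ^ 2 + ‖weakGrad u‖ ^ 2 :=
  WithLp.prod_norm_sq_eq_of_L2 _

/-- `H¹_r(ℝ^N)`: the subspace of the radial functions of `H¹(ℝ^N)`, with the `H¹`-norm. -/
def H1r (N : ℕ) : Submodule ℝ (H1 N) where
  carrier := {u | ∃ ρ : ℝ → ℝ, ∀ᵐ x, fn u x = ρ ‖x‖}
  zero_mem' := by
    refine ⟨0, ?_⟩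
    filter_upwards with x
    simp [fn]
  add_mem' := by
    rintro u w ⟨ρ, hρ⟩ ⟨τ, hτ⟩
    refine ⟨ρ + τ, ?_⟩
    filter_upwards [Lp.coeFn_add (fn u) (fn w), hρ, hτ] with x hx h1 h2
    have : fn (u + w) = fn u + fn w := rfl
    rw [this, hx]
    simp [h1, h2]
  smul_mem' := by
    rintro c u ⟨ρ, hρ⟩
    refine ⟨c • ρ, ?_⟩
    filter_upwards [Lp.coeFn_smul c (fn u), hρ] with x hx h1
    have : fn (c • u) = c • fn u := rfl
    rw [this, hx]
    simp [h1]

/-- `F(t) = ∫₀ᵗ f(τ) dτ`. -/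
def primitive (f : ℝ → ℝ) (t : ℝ) : ℝ := ∫ τ in (0 : ℝ)..t, f τ

/-- The Berestycki-Lions type conditions in dimension `N`. -/
structure BerestyckiLions (N : ℕ) (f : ℝ → ℝ) : Prop where
  /-- `f` is continuous. -/
  continuous : Continuous f
  /-- `f` is odd. -/
  odd : Function.Odd f
  /-- `-∞ < liminf_{t → 0} f(t)/t`. -/
  liminf_zero : (⊥ : EReal) < liminf (fun t : ℝ => ((f t / t : ℝ) : EReal)) (𝓝[≠] 0)
  /-- `limsup_{t → 0} f(t)/t < 0`. -/
  limsup_zero : limsup (fun t : ℝ => ((f t / t : ℝ) : EReal)) (𝓝[≠] 0) < 0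
  /-- Subcritical growth at infinity when `N ≥ 3`. -/
  growth_ge_three : 3 ≤ N →
    Tendsto (fun t : ℝ => f t / |t| ^ (((N : ℝ) + 2) / ((N : ℝ) - 2))) atTop (𝓝 0)
  /-- Subcritical growth at infinity when `N = 2`. -/
  growth_two : N = 2 → ∀ α : ℝ, 0 < α →
    Tendsto (fun t : ℝ => f t / Real.exp (α * t ^ 2)) atTop (𝓝 0)
  /-- `F` is positive somewhere, when `N ≥ 2`. -/
  exists_pos_ge_two : 2 ≤ N → ∃ ζ : ℝ, 0 < ζ ∧ 0 < primitive f ζ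
  /-- The corresponding condition when `N = 1`. -/
  exists_zero_one : N = 1 → ∃ ζ : ℝ, 0 < ζ ∧ (∀ t ∈ Set.Ioo 0 ζ, primitive f t < 0) ∧
    primitive f ζ = 0 ∧ 0 < f ζ

/-- The energy functional
`Φ(u) = (a/2) ∫ |∇u|² + (b/4) (∫ |∇u|²)² - ∫ F(u)` on `H¹(ℝ^N)`. -/
def energy {N : ℕ} (a b : ℝ) (f : ℝ → ℝ) (u : H1 N) : ℝ :=
  1 / 2 * a * (∫ x, ‖weakGrad u x‖ ^ 2) + 1 / 4 * b * (∫ x, ‖weakGrad u x‖ ^ 2) ^ 2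
    - ∫ x, primitive f (fn u x)

/-- `O_r = {u ∈ H¹_r(ℝ^N) : Φ(u) < 0}`, as a subset of the normed space `H¹_r(ℝ^N)`. -/
def negativeSublevel (N : ℕ) (a b : ℝ) (f : ℝ → ℝ) : Set (H1r N) :=
  {u | energy a b f (u : H1 N) < 0}

end Kirchhoff

end

noncomputable section

namespace Kirchhoff

/-! ### Radial test functions in `H1` and smooth one-parameter families of them -/

section

variable {N : ℕ}

/-! Under the dilation u(x/c) the term ∫|∇u|² scales by c^(N-2), its square by c^(2(N-2)), and ∫F(u)
by c^N. For N = 2, 3 both N-2 and 2(N-2) are at most N-1. Hence enlarging a function of negative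
energy keeps the energy negative, and any function with ∫F(u) > 0 acquires negative energy once c is
large. Up to large dilations the problem is therefore to join two functions while keeping ∫F
positive; the gradient terms no longer matter (`toH1r_dilation_mem`,
`eventuallyJoined_of_potential_pos`).

For smooth compactly supported radial φ and ψ with positive ∫F, such a path passes through a plateau
of height ζ on an annulus outside both supports. The outer radius of the annulus grows from the
inner one. If the transition layers are thin, the plateau costs at most a small β at every stage,
and it ends with ∫F as large as desired. Then φ is faded to zero: the loss is bounded, and the
plateau pays for it. The same plateau serves for ψ (`exists_plateau`, `eventuallyJoined_plateau`).
Disjointness of supports makes ∫F additive, and annuli keep everything radial.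

Passing to general elements of the sublevel uses two facts. Radial test functions are dense in
`H1r`, by cutoff and mollification with a radial kernel (`exists_isRadialTest_norm_sub_lt`). The
sublevel is open, because u ↦ ∫F(u) is locally Lipschitz. The latter rests on the Sobolev embedding
into L⁶ for N = 3. For N = 2 it rests on a logarithmic pointwise bound for radial functions, which
takes the place of a Trudinger-Moser inequality (`exists_isWeight_three`, `exists_isWeight_two`). A
point of the sublevel is then joined by a segment inside a ball to a test function, and test
functions are joined as above. -/

lemma inner_gradient (φ : Space N → ℝ) (x v : Space N) :
    inner ℝ (gradient φ x) v = fderiv ℝ φ x v := by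
  rw [← toDual_gradient, InnerProductSpace.toDual_apply_apply]

lemma norm_gradient (φ : Space N → ℝ) (x : Space N) : ‖gradient φ x‖ = ‖fderiv ℝ φ x‖ :=
  LinearIsometryEquiv.norm_map _ _

lemma HasWeakGradient.congr {u u' : Space N → ℝ} {g g' : Space N → Space N}
    (h : HasWeakGradient u g) (hu : u =ᵐ[volume] u') (hg : g =ᵐ[volume] g') :
    HasWeakGradient u' g' := by
  intro φ hφ hc v
  have h1 : (fun x => u' x * fderiv ℝ φ x v) =ᵐ[volume] fun x => u x * fderiv ℝ φ x v := by
    filter_upwards [hu] with x hx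
    rw [hx]
  have h2 : (fun x => φ x * inner ℝ (g' x) v) =ᵐ[volume] fun x => φ x * inner ℝ (g x) v := by
    filter_upwards [hg] with x hx
    rw [hx]
  rw [integral_congr_ae h1, integral_congr_ae h2, h φ hφ hc v]

/-- The element of `H¹` given by a function and its weak gradient. -/
def mkH1 {u : Space N → ℝ} {g : Space N → Space N} (hu : MemLp u 2) (hg : MemLp g 2)
    (h : HasWeakGradient u g) : H1 N :=
  ⟨WithLp.toLp 2 (hu.toLp u, hg.toLp g), h.congr hu.coeFn_toLp.symm hg.coeFn_toLp.symm⟩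

lemma fn_mkH1 {u : Space N → ℝ} {g : Space N → Space N} (hu : MemLp u 2) (hg : MemLp g 2)
    (h : HasWeakGradient u g) : fn (mkH1 hu hg h) =ᵐ[volume] u :=
  hu.coeFn_toLp

lemma weakGrad_mkH1 {u : Space N → ℝ} {g : Space N → Space N} (hu : MemLp u 2) (hg : MemLp g 2)
    (h : HasWeakGradient u g) : weakGrad (mkH1 hu hg h) =ᵐ[volume] g :=
  hg.coeFn_toLp

lemma fn_sub (u w : H1 N) : fn (u - w) = fn u - fn w := rfl

lemma weakGrad_sub (u w : H1 N) : weakGrad (u - w) = weakGrad u - weakGrad w := rfl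

lemma norm_Lp_two_sq {E : Type*} [NormedAddCommGroup E] [InnerProductSpace ℝ E]
    (h : Lp E 2 (volume : Measure (Space N))) : ‖h‖ ^ 2 = ∫ x, ‖h x‖ ^ 2 := by
  rw [← real_inner_self_eq_norm_sq, L2.inner_def]
  simp_rw [real_inner_self_eq_norm_sq]

lemma norm_H1_sq (u : H1 N) : ‖u‖ ^ 2 = (∫ x, ‖fn u x‖ ^ 2) + ∫ x, ‖weakGrad u x‖ ^ 2 := by
  rw [H1_norm_sq_eq, norm_Lp_two_sq, norm_Lp_two_sq]

lemma norm_sub_mkH1_sq (w : H1 N) {u : Space N → ℝ} {g : Space N → Space N} (hu : MemLp u 2)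
    (hg : MemLp g 2) (h : HasWeakGradient u g) :
    ‖w - mkH1 hu hg h‖ ^ 2 = (∫ x, ‖fn w x - u x‖ ^ 2) + ∫ x, ‖weakGrad w x - g x‖ ^ 2 := by
  rw [norm_H1_sq]
  congr 1
  · refine integral_congr_ae ?_
    rw [fn_sub]
    filter_upwards [Lp.coeFn_sub (fn w) (fn (mkH1 hu hg h)), fn_mkH1 hu hg h] with x hx h1
    rw [hx, Pi.sub_apply, h1]
  · refine integral_congr_ae ?_
    rw [weakGrad_sub]
    filter_upwards [Lp.coeFn_sub (weakGrad w) (weakGrad (mkH1 hu hg h)), weakGrad_mkH1 hu hg h]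
      with x hx h1
    rw [hx, Pi.sub_apply, h1]

lemma norm_mkH1_sub_mkH1_sq {u u' : Space N → ℝ} {g g' : Space N → Space N} (hu : MemLp u 2)
    (hg : MemLp g 2) (h : HasWeakGradient u g) (hu' : MemLp u' 2)
    (hg' : MemLp g' 2) (h' : HasWeakGradient u' g') :
    ‖mkH1 hu hg h - mkH1 hu' hg' h'‖ ^ 2
      = (∫ x, ‖u x - u' x‖ ^ 2) + ∫ x, ‖g x - g' x‖ ^ 2 := by
  rw [norm_sub_mkH1_sq]
  congr 1
  · refine integral_congr_ae ?_
    filter_upwards [fn_mkH1 hu hg h] with x h1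
    rw [h1]
  · refine integral_congr_ae ?_
    filter_upwards [weakGrad_mkH1 hu hg h] with x h1
    rw [h1]

/-- Smooth compactly supported radial functions. -/
structure IsRadialTest (φ : Space N → ℝ) : Prop where
  contDiff : ContDiff ℝ ∞ φ
  hasCompactSupport : HasCompactSupport φ
  radial : ∀ x y, ‖x‖ = ‖y‖ → φ x = φ y

lemma continuous_gradient {φ : Space N → ℝ} (hφ : ContDiff ℝ ∞ φ) : Continuous (gradient φ) :=
  (LinearIsometryEquiv.continuous _).comp (hφ.continuous_fderiv (by simp))

lemma hasCompactSupport_gradient {φ : Space N → ℝ} (hφ : HasCompactSupport φ) :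
    HasCompactSupport (gradient φ) :=
  (hφ.fderiv ℝ).comp_left (map_zero (InnerProductSpace.toDual ℝ (Space N)).symm)

lemma hasWeakGradient_gradient {φ : Space N → ℝ} (hφ : ContDiff ℝ ∞ φ)
    (hc : HasCompactSupport φ) : HasWeakGradient φ (gradient φ) := by
  intro ψ hψ hψc v
  have h1 : Continuous (fun x => fderiv ℝ φ x v) :=
    (hφ.continuous_fderiv (by simp)).clm_apply continuous_const
  have h2 : Continuous (fun x => fderiv ℝ ψ x v) :=
    (hψ.continuous_fderiv (by simp)).clm_apply continuous_const
  rw [integral_mul_fderiv_eq_neg_fderiv_mul_of_integrable]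
  · congr 2
    ext x
    rw [inner_gradient, mul_comm]
  · exact (h1.mul hψ.continuous).integrable_of_hasCompactSupport hψc.mul_left
  · exact (hφ.continuous.mul h2).integrable_of_hasCompactSupport hc.mul_right
  · exact (hφ.continuous.mul hψ.continuous).integrable_of_hasCompactSupport hc.mul_right
  · exact fun x _ => hφ.differentiable (by simp) x
  · exact fun x _ => hψ.differentiable (by simp) x

lemma exists_radial_profile {φ : Space N → ℝ} (h : ∀ x y, ‖x‖ = ‖y‖ → φ x = φ y) :
    ∃ ρ : ℝ → ℝ, ∀ x, φ x = ρ ‖x‖ := by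
  classical
  refine ⟨fun r => if hr : ∃ x : Space N, ‖x‖ = r then φ hr.choose else 0, fun x => ?_⟩
  have hx : ∃ y : Space N, ‖y‖ = ‖x‖ := ⟨x, rfl⟩
  refine Eq.trans ?_ (dif_pos hx).symm
  exact h _ _ hx.choose_spec.symm

namespace IsRadialTest

lemma memLp {φ : Space N → ℝ} (h : IsRadialTest φ) (p : ℝ≥0∞) : MemLp φ p :=
  h.contDiff.continuous.memLp_of_hasCompactSupport h.hasCompactSupport

lemma memLp_gradient {φ : Space N → ℝ} (h : IsRadialTest φ) (p : ℝ≥0∞) : MemLp (gradient φ) p :=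
  (continuous_gradient h.contDiff).memLp_of_hasCompactSupport
    (hasCompactSupport_gradient h.hasCompactSupport)

/-- A radial test function as an element of `H¹`. -/
def toH1 {φ : Space N → ℝ} (h : IsRadialTest φ) : H1 N :=
  mkH1 (h.memLp 2) (h.memLp_gradient 2)
    (hasWeakGradient_gradient h.contDiff h.hasCompactSupport)

lemma fn_toH1 {φ : Space N → ℝ} (h : IsRadialTest φ) : fn h.toH1 =ᵐ[volume] φ :=
  fn_mkH1 _ _ _

lemma weakGrad_toH1 {φ : Space N → ℝ} (h : IsRadialTest φ) :
    weakGrad h.toH1 =ᵐ[volume] gradient φ :=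
  weakGrad_mkH1 _ _ _

/-- A radial test function as an element of `H¹_r`. -/
def toH1r {φ : Space N → ℝ} (h : IsRadialTest φ) : H1r N :=
  ⟨h.toH1, by
    obtain ⟨ρ, hρ⟩ := exists_radial_profile h.radial
    refine ⟨ρ, ?_⟩
    filter_upwards [h.fn_toH1] with x hx
    rw [hx, hρ]⟩

lemma smul {φ : Space N → ℝ} (h : IsRadialTest φ) (c : ℝ) : IsRadialTest (fun x => c * φ x) where
  contDiff := contDiff_const.mul h.contDiff
  hasCompactSupport := h.hasCompactSupport.mul_left
  radial x y hxy := by rw [h.radial x y hxy]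

lemma add {φ ψ : Space N → ℝ} (h : IsRadialTest φ) (h' : IsRadialTest ψ) :
    IsRadialTest (fun x => φ x + ψ x) where
  contDiff := h.contDiff.add h'.contDiff
  hasCompactSupport := h.hasCompactSupport.add h'.hasCompactSupport
  radial x y hxy := by rw [h.radial x y hxy, h'.radial x y hxy]

lemma comp_smul {φ : Space N → ℝ} (h : IsRadialTest φ) {c : ℝ} (hc : c ≠ 0) :
    IsRadialTest (fun x => φ (c • x)) where
  contDiff := h.contDiff.comp (contDiff_const_smul c)
  hasCompactSupport := h.hasCompactSupport.comp_smul hc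
  radial x y hxy := h.radial _ _ (by simp [norm_smul, hxy])

lemma exists_support_radius {φ : Space N → ℝ} (h : IsRadialTest φ) :
    ∃ R > 0, ∀ x, R ≤ ‖x‖ → φ x = 0 := by
  obtain ⟨R, hR⟩ := h.hasCompactSupport.isCompact.isBounded.subset_closedBall (0 : Space N)
  refine ⟨max R 0 + 1, by positivity, fun x hx => ?_⟩
  by_contra hne
  have := hR (subset_tsupport _ hne)
  rw [mem_closedBall_zero_iff] at this
  linarith [le_max_left R 0]

end IsRadialTest

/-- `∫ |∇φ|²`. -/
def dirichlet (φ : Space N → ℝ) : ℝ := ∫ x, ‖gradient φ x‖ ^ 2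

/-- `∫ F(φ)`. -/
def potential (f : ℝ → ℝ) (φ : Space N → ℝ) : ℝ := ∫ x, primitive f (φ x)

lemma dirichlet_nonneg (φ : Space N → ℝ) : 0 ≤ dirichlet φ :=
  integral_nonneg fun _ => by positivity

lemma energy_toH1 {φ : Space N → ℝ} (h : IsRadialTest φ) (a b : ℝ) (f : ℝ → ℝ) :
    energy a b f h.toH1 =
      1 / 2 * a * dirichlet φ + 1 / 4 * b * dirichlet φ ^ 2 - potential f φ := by
  have h1 : ∫ x, ‖weakGrad h.toH1 x‖ ^ 2 = dirichlet φ := by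
    refine integral_congr_ae ?_
    filter_upwards [h.weakGrad_toH1] with x hx
    rw [hx]
  have h2 : ∫ x, primitive f (fn h.toH1 x) = potential f φ := by
    refine integral_congr_ae ?_
    filter_upwards [h.fn_toH1] with x hx
    rw [hx]
  rw [energy, h1, h2]

lemma toH1r_mem_negativeSublevel {φ : Space N → ℝ} (h : IsRadialTest φ) {a b : ℝ} {f : ℝ → ℝ} :
    h.toH1r ∈ negativeSublevel N a b f ↔
      1 / 2 * a * dirichlet φ + 1 / 4 * b * dirichlet φ ^ 2 < potential f φ := by
  change energy a b f h.toH1 < 0 ↔ _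
  rw [energy_toH1, sub_neg]

lemma potential_comp_smul (f : ℝ → ℝ) (φ : Space N → ℝ) {c : ℝ} (hc : 0 < c) :
    potential f (fun x => φ (c⁻¹ • x)) = c ^ N * potential f φ := by
  have := Measure.integral_comp_inv_smul_of_nonneg (volume : Measure (Space N))
    (fun x => primitive f (φ x)) hc.le
  simpa [potential] using this

lemma gradient_comp_smul (φ : Space N → ℝ) (c : ℝ) (x : Space N) :
    gradient (fun x => φ (c • x)) x = c • gradient φ (c • x) := by
  have : fderiv ℝ (fun x => φ (c • x)) x = c • fderiv ℝ φ (c • x) := by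
    exact fderiv_comp_smul c (f := φ)
  simp [gradient, this]

/-- The factor c² stands on the left so that the scaling law holds for every N without truncated
subtraction in the exponent. -/
lemma dirichlet_comp_smul (φ : Space N → ℝ) {c : ℝ} (hc : 0 < c) :
    c ^ 2 * dirichlet (fun x => φ (c⁻¹ • x)) = c ^ N * dirichlet φ := by
  have := Measure.integral_comp_inv_smul_of_nonneg (volume : Measure (Space N))
    (fun x => ‖gradient φ x‖ ^ 2) hc.le
  simp only [finrank_euclideanSpace, Fintype.card_fin, smul_eq_mul] at this
  rw [dirichlet, dirichlet, ← this, ← integral_const_mul]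
  congr 1
  ext x
  rw [gradient_comp_smul, norm_smul, mul_pow]
  have : ‖c⁻¹‖ = c⁻¹ := by simp [hc.le]
  rw [this]
  field_simp

/-- Jointly smooth families of radial test functions with uniformly bounded supports. -/
structure IsRadialFamily (Ψ : ℝ → Space N → ℝ) : Prop where
  contDiff : ContDiff ℝ ∞ (Function.uncurry Ψ)
  test : ∀ t, IsRadialTest (Ψ t)
  support : ∃ R : ℝ, ∀ t ∈ Set.Icc (0 : ℝ) 1, ∀ x, R ≤ ‖x‖ → Ψ t x = 0

namespace IsRadialFamily

variable {Ψ : ℝ → Space N → ℝ}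

lemma continuous_gradient (h : IsRadialFamily Ψ) :
    Continuous (fun p : ℝ × Space N => gradient (Ψ p.1) p.2) := by
  refine (LinearIsometryEquiv.continuous _).comp ?_
  refine ContDiff.continuous (𝕜 := ℝ) (n := 0) ?_
  refine ContDiff.fderiv (m := ∞) (f := fun p : ℝ × Space N => Ψ p.1) ?_ contDiff_snd (by simp)
  exact h.contDiff.comp (contDiff_fst.fst.prodMk contDiff_snd)

lemma exists_radius (h : IsRadialFamily Ψ) :
    ∃ R : ℝ, ∀ t ∈ Set.Icc (0 : ℝ) 1, ∀ x, x ∉ Metric.closedBall 0 R →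
      Ψ t x = 0 ∧ gradient (Ψ t) x = 0 := by
  obtain ⟨R, hR⟩ := h.support
  refine ⟨R, fun t ht x hx => ⟨hR t ht x ?_, ?_⟩⟩
  · rw [mem_closedBall_zero_iff, not_le] at hx
    exact hx.le
  · have : Ψ t =ᶠ[𝓝 x] fun _ => 0 := by
      filter_upwards [Metric.isClosed_closedBall.isOpen_compl.mem_nhds hx] with y hy
      rw [Set.mem_compl_iff, mem_closedBall_zero_iff, not_le] at hy
      exact hR t ht y hy.le
    rw [gradient, this.fderiv_eq]
    simp

lemma continuousOn_dirichlet (h : IsRadialFamily Ψ) :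
    ContinuousOn (fun t => dirichlet (Ψ t)) (Set.Icc 0 1) := by
  obtain ⟨R, hR⟩ := h.exists_radius
  refine continuousOn_integral_of_compact_support (isCompact_closedBall (0 : Space N) R)
    (f := fun t x => ‖gradient (Ψ t) x‖ ^ 2) ?_ ?_
  · exact (h.continuous_gradient.norm.pow 2).continuousOn
  · intro t x ht hx
    simp [(hR t ht x hx).2]

/-- The squared distance to a fixed member is an integral, over one compact ball, of a function
jointly continuous in (t, x); it is therefore continuous in t and vanishes at t = s. -/
lemma continuousOn_toH1r (h : IsRadialFamily Ψ) :
    ContinuousOn (fun t => (h.test t).toH1r) (Set.Icc 0 1) := by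
  obtain ⟨R, hR⟩ := h.exists_radius
  intro s hs
  have key : ContinuousOn (fun t => ‖(h.test t).toH1 - (h.test s).toH1‖ ^ 2) (Set.Icc 0 1) := by
    simp_rw [IsRadialTest.toH1, norm_mkH1_sub_mkH1_sq]
    refine ContinuousOn.add ?_ ?_
    · refine continuousOn_integral_of_compact_support (isCompact_closedBall (0 : Space N) R)
        (f := fun t x => ‖Ψ t x - Ψ s x‖ ^ 2) ?_ ?_
      · have h1 : Continuous (fun p : ℝ × Space N => Ψ p.1 p.2) := h.contDiff.continuous
        have h2 : Continuous (fun p : ℝ × Space N => Ψ s p.2) :=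
          (h.test s).contDiff.continuous.comp continuous_snd
        exact ((h1.sub h2).norm.pow 2).continuousOn
      · intro t x ht hx
        simp [(hR t ht x hx).1, (hR s hs x hx).1]
    · refine continuousOn_integral_of_compact_support (isCompact_closedBall (0 : Space N) R)
        (f := fun t x => ‖gradient (Ψ t) x - gradient (Ψ s) x‖ ^ 2) ?_ ?_
      · have h2 : Continuous (fun p : ℝ × Space N => gradient (Ψ s) p.2) :=
          (Kirchhoff.continuous_gradient (h.test s).contDiff).comp continuous_snd
        exact ((h.continuous_gradient.sub h2).norm.pow 2).continuousOn
      · intro t x ht hx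
        simp [(hR t ht x hx).2, (hR s hs x hx).2]
  have h1 := (key s hs).sqrt
  simp only [sub_self, norm_zero, Real.sqrt_sq (norm_nonneg _), ContinuousWithinAt] at h1
  rw [ContinuousWithinAt, tendsto_iff_norm_sub_tendsto_zero]
  convert h1 using 2
  · rfl
  · simp

end IsRadialFamily

end

/-! ### Dilations and paths of positive potential -/

section

variable {N : ℕ} {a b : ℝ} {f : ℝ → ℝ}

lemma joinedIn_of_isRadialFamily {Ψ : ℝ → Space N → ℝ} (h : IsRadialFamily Ψ)
    {s : Set (H1r N)} (hs : ∀ t ∈ Set.Icc (0 : ℝ) 1, (h.test t).toH1r ∈ s)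
    {φ ψ : Space N → ℝ} (hφ : IsRadialTest φ) (hψ : IsRadialTest ψ) (h0 : Ψ 0 = φ)
    (h1 : Ψ 1 = ψ) : JoinedIn s hφ.toH1r hψ.toH1r := by
  subst h0 h1
  refine JoinedIn.ofLine h.continuousOn_toH1r rfl rfl ?_
  rintro _ ⟨t, ht, rfl⟩
  exact hs t ht

lemma IsRadialFamily.comp_smul {Ψ : ℝ → Space N → ℝ} (h : IsRadialFamily Ψ) {c : ℝ}
    (hc : 0 < c) : IsRadialFamily (fun t x => Ψ t (c • x)) where
  contDiff := h.contDiff.comp (contDiff_fst.prodMk (contDiff_snd.const_smul c))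
  test t := (h.test t).comp_smul hc.ne'
  support := by
    obtain ⟨R, hR⟩ := h.support
    refine ⟨c⁻¹ * R, fun t ht x hx => hR t ht _ ?_⟩
    rw [norm_smul, Real.norm_of_nonneg hc.le]
    rwa [inv_mul_le_iff₀ hc] at hx

/-- The exponential parametrisation keeps the dilation factor positive for every real t, so the
family is smooth on the whole line. -/
lemma IsRadialTest.dilationFamily {φ : Space N → ℝ} (h : IsRadialTest φ) (s : ℝ) :
    IsRadialFamily (fun t x => φ ((Real.exp (t * s))⁻¹ • x)) where
  contDiff := by
    have h1 : ContDiff ℝ ∞ fun z : ℝ × Space N => (Real.exp (z.1 * s))⁻¹ := by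
      simp_rw [← Real.exp_neg]
      exact ((contDiff_fst.mul contDiff_const).neg).exp
    exact h.contDiff.comp (h1.smul contDiff_snd)
  test t := h.comp_smul (by positivity)
  support := by
    obtain ⟨R, hR0, hR⟩ := h.exists_support_radius
    refine ⟨Real.exp |s| * R, fun t ht x hx => hR _ ?_⟩
    rw [norm_smul, norm_inv, Real.norm_of_nonneg (Real.exp_pos _).le,
      le_inv_mul_iff₀ (Real.exp_pos _)]
    refine le_trans (mul_le_mul_of_nonneg_right (Real.exp_le_exp.2 ?_) hR0.le) hx
    calc t * s ≤ |t * s| := le_abs_self _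
      _ = t * |s| := by rw [abs_mul, abs_of_nonneg ht.1]
      _ ≤ 1 * |s| := mul_le_mul_of_nonneg_right ht.2 (abs_nonneg s)
      _ = |s| := one_mul _

lemma dirichlet_dilation (hN : 2 ≤ N) (φ : Space N → ℝ) {c : ℝ} (hc : 0 < c) :
    dirichlet (fun x => φ (c⁻¹ • x)) = c ^ (N - 2) * dirichlet φ := by
  have h := dirichlet_comp_smul φ hc
  obtain ⟨k, rfl⟩ := Nat.exists_eq_add_of_le hN
  rw [pow_add, mul_assoc] at h
  simpa using mul_left_cancel₀ (by positivity) h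

/-- Since N-2 ≤ N and 2(N-2) ≤ N, the gradient terms grow by at most c^N, while the potential grows
by exactly c^N. -/
lemma toH1r_dilation_mem (ha : 0 ≤ a) (hb : 0 < b) (hN : N = 2 ∨ N = 3) {φ : Space N → ℝ}
    (h : IsRadialTest φ) (hφ : h.toH1r ∈ negativeSublevel N a b f) {c : ℝ} (hc : 1 ≤ c)
    (h' : IsRadialTest (fun x => φ (c⁻¹ • x))) : h'.toH1r ∈ negativeSublevel N a b f := by
  have hc0 : 0 < c := by linarith
  rw [toH1r_mem_negativeSublevel] at hφ ⊢
  rw [potential_comp_smul f φ hc0, dirichlet_dilation (by omega) φ hc0]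
  have hA := dirichlet_nonneg φ
  set A := dirichlet φ
  have e1 : c ^ (N - 2) ≤ c ^ N := pow_le_pow_right₀ hc (by omega)
  have e2 : (c ^ (N - 2)) ^ 2 ≤ c ^ N := by
    rw [← pow_mul]
    exact pow_le_pow_right₀ hc (by omega)
  have f1 : 1 / 2 * a * (c ^ (N - 2) * A) ≤ c ^ N * (1 / 2 * a * A) := by
    have := mul_le_mul_of_nonneg_right e1 (by positivity : 0 ≤ 1 / 2 * a * A)
    linarith
  have f2 : 1 / 4 * b * (c ^ (N - 2) * A) ^ 2 ≤ c ^ N * (1 / 4 * b * A ^ 2) := by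
    have := mul_le_mul_of_nonneg_right e2 (by positivity : 0 ≤ 1 / 4 * b * A ^ 2)
    rw [mul_pow]
    linarith
  have f3 := mul_lt_mul_of_pos_left hφ (by positivity : 0 < c ^ N)
  linarith

lemma joinedIn_dilation (ha : 0 ≤ a) (hb : 0 < b) (hN : N = 2 ∨ N = 3) {φ : Space N → ℝ}
    (h : IsRadialTest φ) (hφ : h.toH1r ∈ negativeSublevel N a b f) {c : ℝ} (hc : 1 ≤ c)
    (h' : IsRadialTest (fun x => φ (c⁻¹ • x))) :
    JoinedIn (negativeSublevel N a b f) h.toH1r h'.toH1r := by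
  have hc0 : 0 < c := by linarith
  refine joinedIn_of_isRadialFamily (h.dilationFamily (Real.log c)) (fun t ht => ?_) h h' ?_ ?_
  · refine toH1r_dilation_mem ha hb hN h hφ ?_ _
    exact Real.one_le_exp (mul_nonneg ht.1 (Real.log_nonneg hc))
  · simp
  · simp [Real.exp_log hc0]

/-- After any large enough dilation, `φ` and `ψ` are joined in the negative sublevel set. -/
def EventuallyJoined (a b : ℝ) (f : ℝ → ℝ) (φ ψ : Space N → ℝ) : Prop :=
  ∃ S₀ : ℝ, ∀ S : ℝ, S₀ ≤ S → ∀ (hφ : IsRadialTest (fun x => φ (S⁻¹ • x)))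
    (hψ : IsRadialTest (fun x => ψ (S⁻¹ • x))),
    JoinedIn (negativeSublevel N a b f) hφ.toH1r hψ.toH1r

lemma EventuallyJoined.symm {φ ψ : Space N → ℝ} (h : EventuallyJoined a b f φ ψ) :
    EventuallyJoined a b f ψ φ := by
  obtain ⟨S₀, h⟩ := h
  exact ⟨S₀, fun S hS hφ hψ => (h S hS hψ hφ).symm⟩

lemma EventuallyJoined.trans {φ ψ χ : Space N → ℝ} (hψ : IsRadialTest ψ)
    (h : EventuallyJoined a b f φ ψ) (h' : EventuallyJoined a b f ψ χ) :
    EventuallyJoined a b f φ χ := by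
  obtain ⟨S₀, h⟩ := h
  obtain ⟨S₁, h'⟩ := h'
  refine ⟨max (max S₀ S₁) 1, fun S hS hφ hχ => ?_⟩
  simp only [max_le_iff] at hS
  have hS0 : S⁻¹ ≠ 0 := inv_ne_zero (by linarith)
  exact (h S hS.1.1 hφ (hψ.comp_smul hS0)).trans (h' S hS.1.2 (hψ.comp_smul hS0) hχ)

/-- Both gradient terms grow by at most S^(N-1), as 2(N-2) ≤ N-1 for N = 2, 3. The potential grows
by S^N, and the spare factor S wins uniformly along the path because the Dirichlet integrals are
bounded on [0, 1]. -/
lemma eventuallyJoined_of_potential_pos (ha : 0 ≤ a) (hb : 0 < b) (hN : N = 2 ∨ N = 3)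
    {Ψ : ℝ → Space N → ℝ} (h : IsRadialFamily Ψ) {ε : ℝ} (hε : 0 < ε)
    (hΨ : ∀ t ∈ Set.Icc (0 : ℝ) 1, ε ≤ potential f (Ψ t)) :
    EventuallyJoined a b f (Ψ 0) (Ψ 1) := by
  obtain ⟨K, hK⟩ := (isCompact_Icc.image_of_continuousOn h.continuousOn_dirichlet).bddAbove
  have hK' : ∀ t ∈ Set.Icc (0 : ℝ) 1, dirichlet (Ψ t) ≤ K := fun t ht =>
    hK (Set.mem_image_of_mem _ ht)
  -- An upper bound for the gradient part of the energy along the undilated family; the threshold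
  -- M/ε + 1 for S then forces M < S ε.
  set M : ℝ := 1 / 2 * a * K + 1 / 4 * b * K ^ 2
  refine ⟨max 1 (M / ε + 1), fun S hS hφ hψ => ?_⟩
  have hS1 : 1 ≤ S := (le_max_left _ _).trans hS
  have hS0 : 0 < S := by linarith
  have hSM : M < S * ε := by
    have := (le_max_right 1 (M / ε + 1)).trans hS
    rw [← div_lt_iff₀ hε]
    linarith
  refine joinedIn_of_isRadialFamily (h.comp_smul (inv_pos.2 hS0)) (fun t ht => ?_) hφ hψ rfl rfl
  rw [toH1r_mem_negativeSublevel, potential_comp_smul f (Ψ t) hS0,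
    dirichlet_dilation (by omega) (Ψ t) hS0]
  have hA0 := dirichlet_nonneg (Ψ t)
  have hA := hK' t ht
  have hB := hΨ t ht
  set A := dirichlet (Ψ t)
  set B := potential f (Ψ t)
  have e1 : S ^ (N - 2) ≤ S ^ (N - 1) := pow_le_pow_right₀ hS1 (by omega)
  have e2 : (S ^ (N - 2)) ^ 2 ≤ S ^ (N - 1) := by
    rw [← pow_mul]
    exact pow_le_pow_right₀ hS1 (by omega)
  have e3 : S ^ N = S ^ (N - 1) * S := by
    rw [← pow_succ]
    congr 1
    omega
  have f0 : A ^ 2 ≤ K ^ 2 := pow_le_pow_left₀ hA0 hA 2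
  have f1 : 1 / 2 * a * (S ^ (N - 2) * A) ≤ S ^ (N - 1) * (1 / 2 * a * K) := by
    have := mul_le_mul e1 hA hA0 (by positivity)
    have := mul_le_mul_of_nonneg_left this (by positivity : 0 ≤ 1 / 2 * a)
    linarith
  have f2 : 1 / 4 * b * (S ^ (N - 2) * A) ^ 2 ≤ S ^ (N - 1) * (1 / 4 * b * K ^ 2) := by
    have := mul_le_mul e2 f0 (by positivity) (by positivity)
    have := mul_le_mul_of_nonneg_left this (by positivity : 0 ≤ 1 / 4 * b)
    rw [mul_pow]
    linarith
  have f3 : S ^ (N - 1) * M < S ^ (N - 1) * (S * ε) :=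
    mul_lt_mul_of_pos_left hSM (by positivity)
  have f4 : S ^ (N - 1) * (S * ε) ≤ S ^ N * B := by
    rw [e3, mul_assoc]
    gcongr
  have f5 : S ^ (N - 1) * M = S ^ (N - 1) * (1 / 2 * a * K) + S ^ (N - 1) * (1 / 4 * b * K ^ 2) := by
    ring
  linarith

/-! ### Annular plateaus -/

/-- Profiles in |x|² rather than |x| are smooth at the origin with no further condition. -/
lemma isRadialTest_of_normSq {φ : Space N → ℝ} {g : ℝ → ℝ} (hg : ContDiff ℝ ∞ g) {q : ℝ}
    (hq : ∀ r, q ≤ r → g r = 0) (h : ∀ x, φ x = g (‖x‖ ^ 2)) : IsRadialTest φ where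
  contDiff := by
    rw [funext h]
    exact hg.comp (contDiff_norm_sq ℝ)
  hasCompactSupport := by
    refine HasCompactSupport.intro (isCompact_closedBall (0 : Space N) (max q 1)) fun x hx => ?_
    rw [mem_closedBall_zero_iff, not_le, max_lt_iff] at hx
    rw [h, hq]
    nlinarith [hx.1, hx.2]
  radial x y hxy := by rw [h, h, hxy]

/-- A smooth radial function equal to `1` for `p + δ ≤ |x|² ≤ q - δ` and to `0` for `|x|² ≤ p` and
for `|x|² ≥ q`. -/
def plateau (p q δ : ℝ) (x : Space N) : ℝ :=
  Real.smoothTransition ((q - ‖x‖ ^ 2) / δ) * Real.smoothTransition ((‖x‖ ^ 2 - p) / δ)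

lemma plateau_nonneg (p q δ : ℝ) (x : Space N) : 0 ≤ plateau p q δ x :=
  mul_nonneg (Real.smoothTransition.nonneg _) (Real.smoothTransition.nonneg _)

lemma plateau_le_one (p q δ : ℝ) (x : Space N) : plateau p q δ x ≤ 1 :=
  mul_le_one₀ (Real.smoothTransition.le_one _) (Real.smoothTransition.nonneg _)
    (Real.smoothTransition.le_one _)

lemma plateau_eq_zero_of_le {p q δ : ℝ} (hδ : 0 < δ) {x : Space N} (hx : ‖x‖ ^ 2 ≤ p) :
    plateau p q δ x = 0 := by
  rw [plateau, Real.smoothTransition.zero_of_nonpos (x := (‖x‖ ^ 2 - p) / δ), mul_zero]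
  exact div_nonpos_of_nonpos_of_nonneg (by linarith) hδ.le

lemma plateau_eq_zero_of_ge {p q δ : ℝ} (hδ : 0 < δ) {x : Space N} (hx : q ≤ ‖x‖ ^ 2) :
    plateau p q δ x = 0 := by
  rw [plateau, Real.smoothTransition.zero_of_nonpos (x := (q - ‖x‖ ^ 2) / δ), zero_mul]
  exact div_nonpos_of_nonpos_of_nonneg (by linarith) hδ.le

lemma plateau_eq_one {p q δ : ℝ} (hδ : 0 < δ) {x : Space N} (h1 : p + δ ≤ ‖x‖ ^ 2)
    (h2 : ‖x‖ ^ 2 ≤ q - δ) : plateau p q δ x = 1 := by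
  rw [plateau, Real.smoothTransition.one_of_one_le, Real.smoothTransition.one_of_one_le, mul_one]
  · rw [one_le_div hδ]
    linarith
  · rw [one_le_div hδ]
    linarith

lemma isRadialTest_plateau (p q : ℝ) {δ : ℝ} (hδ : 0 < δ) :
    IsRadialTest (plateau p q δ : Space N → ℝ) := by
  refine isRadialTest_of_normSq (q := q) (g := fun r => Real.smoothTransition ((q - r) / δ) *
    Real.smoothTransition ((r - p) / δ)) ?_ (fun r hr => ?_) fun x => rfl
  · exact (Real.smoothTransition.contDiff.comp ((contDiff_const.sub contDiff_id).div_const δ)).mul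
      (Real.smoothTransition.contDiff.comp ((contDiff_id.sub contDiff_const).div_const δ))
  · rw [Real.smoothTransition.zero_of_nonpos, zero_mul]
    exact div_nonpos_of_nonpos_of_nonneg (by linarith) hδ.le

/-- The closed annulus `s ≤ |x|² ≤ t`. -/
def annulus (N : ℕ) (s t : ℝ) : Set (Space N) := {x | s ≤ ‖x‖ ^ 2 ∧ ‖x‖ ^ 2 ≤ t}

lemma annulus_eq {s t : ℝ} (ht : 0 ≤ t) :
    annulus N s t = Metric.closedBall 0 √t \ Metric.ball 0 √s := by
  ext x
  simp only [annulus, Set.mem_ofPred_eq, Set.mem_sdiff, mem_closedBall_zero_iff,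
    mem_ball_zero_iff, not_lt, Real.le_sqrt (norm_nonneg x) ht, Real.sqrt_le_left (norm_nonneg x)]
  tauto

lemma isClosed_annulus (s t : ℝ) : IsClosed (annulus N s t) := by
  have h : Continuous fun x : Space N => ‖x‖ ^ 2 := by fun_prop
  exact (isClosed_le continuous_const h).inter (isClosed_le h continuous_const)

lemma volume_annulus_lt_top (s t : ℝ) : volume (annulus N s t) < ⊤ := by
  refine lt_of_le_of_lt (measure_mono fun x hx => ?_)
    (isCompact_closedBall (0 : Space N) (max t 1)).measure_lt_top
  rw [mem_closedBall_zero_iff]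
  by_contra! h
  rw [max_lt_iff] at h
  have := hx.2
  nlinarith [h.1, h.2]

lemma volume_real_annulus (hN : 0 < N) {s t : ℝ} (hs : 0 ≤ s) (hst : s ≤ t) :
    volume.real (annulus N s t)
      = (√t ^ N - √s ^ N) * volume.real (Metric.ball (0 : Space N) 1) := by
  have : Nonempty (Fin N) := ⟨⟨0, hN⟩⟩
  rw [annulus_eq (hs.trans hst), measureReal_sdiff (fun x hx => ?_) measurableSet_ball measure_closedBall_lt_top.ne,
    ← Measure.addHaar_real_closedBall_eq_addHaar_real_ball _ _ √s,
    Measure.addHaar_real_closedBall _ _ (Real.sqrt_nonneg t),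
    Measure.addHaar_real_closedBall _ _ (Real.sqrt_nonneg s)]
  · simp [sub_mul]
  · exact Metric.ball_subset_closedBall.trans
      (Metric.closedBall_subset_closedBall (Real.sqrt_le_sqrt hst)) hx

/-- The volume is a difference of values of a multiple of √r ^ N, which is uniformly continuous on
[0, Q + 1]; this makes δ independent of s. -/
lemma exists_forall_volume_annulus_le (hN : 0 < N) (Q : ℝ) {η : ℝ} (hη : 0 < η) :
    ∃ δ > 0, δ ≤ 1 ∧ ∀ s, 0 ≤ s → s ≤ Q → volume.real (annulus N s (s + δ)) ≤ η := by
  have hc : ContinuousOn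
      (fun r : ℝ => √r ^ N * volume.real (Metric.ball (0 : Space N) 1)) (Set.Icc 0 (Q + 1)) := by
    fun_prop
  have hu := isCompact_Icc.uniformContinuousOn_of_continuous hc
  rw [Metric.uniformContinuousOn_iff_le] at hu
  obtain ⟨δ, hδ, h⟩ := hu η hη
  refine ⟨min δ 1, by positivity, min_le_right _ _, fun s hs hsQ => ?_⟩
  have h1 : min δ 1 ≤ 1 := min_le_right _ _
  have h2 : min δ 1 ≤ δ := min_le_left _ _
  have h3 : 0 < min δ 1 := by positivity
  have := h (s + min δ 1) ⟨by linarith, by linarith⟩ s ⟨hs, by linarith⟩ (by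
    rw [Real.dist_eq, add_sub_cancel_left, abs_of_pos h3]
    exact h2)
  rw [volume_real_annulus hN hs (by linarith), sub_mul]
  exact (le_abs_self _).trans this

lemma exists_le_volume_annulus (hN : 0 < N) (p K : ℝ) (hp : 0 ≤ p) :
    ∃ Q, p ≤ Q ∧ K ≤ volume.real (annulus N p Q) := by
  have hω : 0 < volume.real (Metric.ball (0 : Space N) 1) :=
    ENNReal.toReal_pos (Metric.measure_ball_pos _ _ one_pos).ne' measure_ball_lt_top.ne
  have ht : Tendsto (fun Q : ℝ => (√Q ^ N - √p ^ N) * volume.real (Metric.ball (0 : Space N) 1))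
      atTop atTop := by
    refine Tendsto.atTop_mul_const hω ?_
    exact tendsto_atTop_add_const_right _ _
      ((tendsto_pow_atTop hN.ne').comp Real.tendsto_sqrt_atTop)
  obtain ⟨Q, hQ, hQp⟩ := ((ht.eventually_ge_atTop K).and (eventually_ge_atTop p)).exists
  exact ⟨Q, hQp, by rwa [volume_real_annulus hN hp hQp]⟩

lemma continuous_primitive (hf : Continuous f) : Continuous (primitive f) :=
  intervalIntegral.continuous_primitive (fun _ _ => hf.intervalIntegrable _ _) 0

lemma primitive_zero (f : ℝ → ℝ) : primitive f 0 = 0 := by simp [primitive]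

lemma integrable_primitive_comp (hf : Continuous f) {φ : Space N → ℝ} (h : IsRadialTest φ) :
    Integrable (fun x => primitive f (φ x)) :=
  ((continuous_primitive hf).comp h.contDiff.continuous).integrable_of_hasCompactSupport
    (h.hasCompactSupport.comp_left (primitive_zero f))

lemma potential_add (hf : Continuous f) {φ ψ : Space N → ℝ} (h : IsRadialTest φ)
    (h' : IsRadialTest ψ) (hφψ : ∀ x, φ x = 0 ∨ ψ x = 0) :
    potential f (fun x => φ x + ψ x) = potential f φ + potential f ψ := by
  rw [potential, potential, potential, ← integral_add (integrable_primitive_comp hf h)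
    (integrable_primitive_comp hf h')]
  congr 1
  ext x
  rcases hφψ x with h0 | h0 <;> simp [h0, primitive_zero]

/-- The integrand is F(ζ) on the flat part, at least -C on the two layers, and zero elsewhere. The
layers may overlap when q is close to p; the flat annulus is then empty and the pointwise bound
persists. -/
lemma le_potential_plateau (hf : Continuous f) {ζ C : ℝ}
    (hζ0 : 0 < ζ) (hC0 : 0 ≤ C) (hC : ∀ t ∈ Set.Icc 0 ζ, -C ≤ primitive f t) (p q : ℝ) {δ : ℝ}
    (hδ : 0 < δ) :
    primitive f ζ * volume.real (annulus N (p + δ) (q - δ))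
        - C * volume.real (annulus N p (p + δ)) - C * volume.real (annulus N (q - δ) q)
      ≤ potential f (fun x : Space N => ζ * plateau p q δ x) := by
  have hint : ∀ (c s t : ℝ), Integrable ((annulus N s t).indicator fun _ => c) := fun c s t =>
    IntegrableOn.integrable_indicator
      (integrableOn_const (volume_annulus_lt_top s t).ne) (isClosed_annulus s t).measurableSet
  have hval : ∀ (c s t : ℝ), ∫ x, (annulus N s t).indicator (fun _ => c) x
      = c * volume.real (annulus N s t) := fun c s t => by
    rw [integral_indicator_const _ (isClosed_annulus s t).measurableSet, smul_eq_mul, mul_comm]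
  rw [← hval, ← hval, ← hval, ← integral_sub' (hint _ _ _) (hint _ _ _),
    ← integral_sub' ((hint _ _ _).sub (hint _ _ _)) (hint _ _ _)]
  refine integral_mono (((hint _ _ _).sub (hint _ _ _)).sub (hint _ _ _))
    (integrable_primitive_comp hf ((isRadialTest_plateau p q hδ).smul ζ)) fun x => ?_
  have h0 : -C ≤ primitive f (ζ * plateau p q δ x) :=
    hC _ ⟨mul_nonneg hζ0.le (plateau_nonneg _ _ _ _),
      mul_le_of_le_one_right hζ0.le (plateau_le_one _ _ _ _)⟩
  have i1 : 0 ≤ (annulus N p (p + δ)).indicator (fun _ => C) x :=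
    Set.indicator_nonneg (fun _ _ => hC0) _
  have i2 : 0 ≤ (annulus N (q - δ) q).indicator (fun _ => C) x :=
    Set.indicator_nonneg (fun _ _ => hC0) _
  simp only [Pi.sub_apply]
  by_cases h1 : x ∈ annulus N (p + δ) (q - δ)
  · rw [Set.indicator_of_mem h1, plateau_eq_one hδ h1.1 h1.2, mul_one]
    linarith
  rw [Set.indicator_of_notMem h1]
  by_cases h2 : x ∈ annulus N p (p + δ)
  · rw [Set.indicator_of_mem h2]
    linarith
  by_cases h3 : x ∈ annulus N (q - δ) q
  · rw [Set.indicator_of_mem h3]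
    linarith
  have h4 : plateau p q δ x = 0 := by
    simp only [annulus, Set.mem_ofPred_eq, not_and, not_le] at h1 h2 h3
    by_cases h5 : ‖x‖ ^ 2 ≤ p
    · exact plateau_eq_zero_of_le hδ h5
    · refine plateau_eq_zero_of_ge hδ ?_
      by_contra! h6
      have := h2 (by linarith)
      have := h1 this.le
      linarith [h3 this.le]
  rw [h4, mul_zero, primitive_zero]
  linarith

/-- The order of choices matters: the outer radius is fixed by the required gain K, and only then is
the layer width δ chosen, small for all radii up to that one. One δ thus serves the entire growth of
the annulus. -/
lemma exists_plateau (hN : 0 < N) (hf : Continuous f) {ζ : ℝ} (hζ : 0 < primitive f ζ)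
    (hζ0 : 0 < ζ) {p β : ℝ} (hp : 1 ≤ p) (hβ : 0 < β) (K : ℝ) :
    ∃ Q δ, p ≤ Q ∧ 0 < δ ∧
      (∀ q ∈ Set.Icc p Q, -β ≤ potential f (fun x : Space N => ζ * plateau p q δ x)) ∧
      K ≤ potential f (fun x : Space N => ζ * plateau p Q δ x) := by
  obtain ⟨C, hC⟩ := (isCompact_Icc.image_of_continuousOn
    (continuous_primitive hf).neg.continuousOn (s := Set.Icc 0 ζ)).bddAbove
  have hC' : ∀ t ∈ Set.Icc 0 ζ, -max C 1 ≤ primitive f t := fun t ht => by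
    have : -primitive f t ≤ C := hC (Set.mem_image_of_mem _ ht)
    linarith [le_max_left C 1]
  have hC1 : 1 ≤ max C 1 := le_max_right _ _
  set D := max C 1
  -- The final outer threshold will be Q + 1. As δ ≤ 1, its flat part contains the annulus from p +
  -- 1 to Q, whose contribution is at least K + β.
  obtain ⟨Q, hQ, hQK⟩ := exists_le_volume_annulus hN (p + 1) ((K + β) / primitive f ζ)
    (by linarith)
  -- Each of the two layers then costs at most β / 2.
  have hη : 0 < β / (2 * D) := by positivity
  obtain ⟨δ, hδ, hδ1, hsmall⟩ := exists_forall_volume_annulus_le hN (Q + 1) hη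
  have hDη : D * (β / (2 * D)) = β / 2 := by field_simp
  have key : ∀ q ∈ Set.Icc p (Q + 1),
      primitive f ζ * volume.real (annulus N (p + δ) (q - δ)) - β ≤
        potential f (fun x : Space N => ζ * plateau p q δ x) := fun q hq => by
    have h1 := hsmall p (by linarith) (by linarith [hq.1, hq.2])
    have h2 := hsmall (q - δ) (by linarith [hq.1]) (by linarith [hq.2])
    rw [sub_add_cancel] at h2
    have h3 := le_potential_plateau (N := N) hf hζ0 (by linarith) hC' p q hδ
    have h4 := mul_le_mul_of_nonneg_left h1 (by linarith : 0 ≤ D)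
    have h5 := mul_le_mul_of_nonneg_left h2 (by linarith : 0 ≤ D)
    linarith
  refine ⟨Q + 1, δ, by linarith, hδ, fun q hq => ?_, ?_⟩
  · have : 0 ≤ primitive f ζ * volume.real (annulus N (p + δ) (q - δ)) := by positivity
    linarith [key q hq]
  · have h1 := key (Q + 1) ⟨by linarith, le_rfl⟩
    have h2 : volume.real (annulus N (p + 1) Q) ≤ volume.real (annulus N (p + δ) (Q + 1 - δ)) :=
      measureReal_mono (fun x hx => ⟨by linarith [hx.1], by linarith [hx.2]⟩)
        (volume_annulus_lt_top _ _).ne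
    rw [div_le_iff₀ hζ] at hQK
    have h3 := mul_le_mul_of_nonneg_left h2 hζ.le
    linarith

lemma isRadialFamily_add_plateau {φ : Space N → ℝ} (h : IsRadialTest φ) (ζ : ℝ) {p Q δ : ℝ}
    (hQ : p ≤ Q) (hδ : 0 < δ) :
    IsRadialFamily (fun t x => φ x + ζ * plateau p (p + t * (Q - p)) δ x) where
  contDiff := by
    have hn : ContDiff ℝ ∞ fun z : ℝ × Space N => ‖z.2‖ ^ 2 :=
      (contDiff_norm_sq ℝ).comp contDiff_snd
    refine (h.contDiff.comp contDiff_snd).add (contDiff_const.mul (ContDiff.mul ?_ ?_))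
    · exact Real.smoothTransition.contDiff.comp
        (((contDiff_const.add (contDiff_fst.mul contDiff_const)).sub hn).div_const δ)
    · exact Real.smoothTransition.contDiff.comp ((hn.sub contDiff_const).div_const δ)
  test t := h.add ((isRadialTest_plateau _ _ hδ).smul ζ)
  support := by
    obtain ⟨R, hR0, hR⟩ := h.exists_support_radius
    refine ⟨max R (max Q 1), fun t ht x hx => ?_⟩
    simp only [max_le_iff] at hx
    rw [hR x hx.1, plateau_eq_zero_of_ge hδ, mul_zero, add_zero]
    have : t * (Q - p) ≤ 1 * (Q - p) := mul_le_mul_of_nonneg_right ht.2 (by linarith)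
    nlinarith [hx.2.1, hx.2.2]

lemma isRadialFamily_affine {φ ψ : Space N → ℝ} (h : IsRadialTest φ) (h' : IsRadialTest ψ) :
    IsRadialFamily (fun t x => (1 - t) * φ x + ψ x) where
  contDiff := ((contDiff_const.sub contDiff_fst).mul (h.contDiff.comp contDiff_snd)).add
    (h'.contDiff.comp contDiff_snd)
  test t := (h.smul (1 - t)).add h'
  support := by
    obtain ⟨R, hR0, hR⟩ := h.exists_support_radius
    obtain ⟨R', hR0', hR'⟩ := h'.exists_support_radius
    refine ⟨max R R', fun t ht x hx => ?_⟩
    rw [max_le_iff] at hx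
    rw [hR x hx.1, hR' x hx.2, mul_zero, add_zero]

/-- Scaling φ down to zero can make the potential negative; K bounds this loss, which the plateau
must compensate. -/
lemma exists_le_potential_smul (hf : Continuous f) {φ : Space N → ℝ} (h : IsRadialTest φ) :
    ∃ K, ∀ t ∈ Set.Icc (0 : ℝ) 1, -K ≤ potential f (fun x => (1 - t) * φ x) := by
  have hc : ContinuousOn (fun t : ℝ => potential f (fun x => (1 - t) * φ x)) (Set.Icc 0 1) := by
    refine continuousOn_integral_of_compact_support h.hasCompactSupport.isCompact
      (f := fun t x => primitive f ((1 - t) * φ x)) ?_ ?_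
    · exact ((continuous_primitive hf).comp ((continuous_const.sub continuous_fst).mul
        (h.contDiff.continuous.comp continuous_snd))).continuousOn
    · intro t x _ hx
      rw [image_eq_zero_of_notMem_tsupport hx, mul_zero, primitive_zero]
  obtain ⟨K, hK⟩ := (isCompact_Icc.image_of_continuousOn hc).bddBelow
  exact ⟨-K, fun t ht => by simpa using hK (Set.mem_image_of_mem _ ht)⟩

/-- Two moves: grow the plateau beside φ, where the potential stays at least 2β - β, then fade φ
out, where it stays at least (K + 1) - K. -/
lemma eventuallyJoined_plateau (ha : 0 ≤ a) (hb : 0 < b) (hN : N = 2 ∨ N = 3)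
    (hf : Continuous f) {φ : Space N → ℝ} (h : IsRadialTest φ) {ζ p Q δ β K : ℝ} (hδ : 0 < δ)
    (hpQ : p ≤ Q) (hp : ∀ x, p ≤ ‖x‖ ^ 2 → φ x = 0) (hβ : 0 < β)
    (hφβ : 2 * β ≤ potential f φ)
    (hK : ∀ t ∈ Set.Icc (0 : ℝ) 1, -K ≤ potential f (fun x => (1 - t) * φ x))
    (h1 : ∀ q ∈ Set.Icc p Q, -β ≤ potential f (fun x : Space N => ζ * plateau p q δ x))
    (h2 : K + 1 ≤ potential f (fun x : Space N => ζ * plateau p Q δ x)) :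
    EventuallyJoined a b f φ (fun x => ζ * plateau p Q δ x) := by
  have hdisj : ∀ (q : ℝ) (x : Space N), φ x = 0 ∨ ζ * plateau p q δ x = 0 := fun q x => by
    rcases le_total p (‖x‖ ^ 2) with hx | hx
    · exact Or.inl (hp x hx)
    · exact Or.inr (by rw [plateau_eq_zero_of_le hδ hx, mul_zero])
  have htest : ∀ q : ℝ, IsRadialTest (fun x : Space N => ζ * plateau p q δ x) := fun q =>
    (isRadialTest_plateau p q hδ).smul ζ
  have e1 : EventuallyJoined a b f φ (fun x => φ x + ζ * plateau p Q δ x) := by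
    have := eventuallyJoined_of_potential_pos (f := f) ha hb hN
      (isRadialFamily_add_plateau h ζ hpQ hδ) hβ fun t ht => by
        rw [potential_add hf h (htest _) (hdisj _)]
        have := h1 (p + t * (Q - p)) ⟨by nlinarith [ht.1], by nlinarith [ht.2]⟩
        linarith
    convert this using 1
    -- At t = 0 the plateau has q = p, so one of its two factors vanishes at every point.
    · ext x
      rcases le_total p (‖x‖ ^ 2) with hx | hx
      · rw [plateau_eq_zero_of_ge hδ (by simpa using hx), mul_zero, add_zero]
      · rw [plateau_eq_zero_of_le hδ hx, mul_zero, add_zero]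
    · ext x
      simp
  have e2 : EventuallyJoined a b f (fun x => φ x + ζ * plateau p Q δ x)
      (fun x => ζ * plateau p Q δ x) := by
    have := eventuallyJoined_of_potential_pos (f := f) ha hb hN
      (isRadialFamily_affine h (htest Q)) one_pos fun t ht => by
        rw [potential_add hf (h.smul (1 - t)) (htest _) fun x => ?_]
        · linarith [hK t ht]
        · rcases hdisj Q x with h0 | h0
          · exact Or.inl (by rw [h0, mul_zero])
          · exact Or.inr h0
    convert this using 1
    · ext x
      simp
    · ext x
      simp
  exact e1.trans (h.add (htest Q)) e2

lemma eventuallyJoined_of_potential_pos_of_potential_pos (ha : 0 ≤ a) (hb : 0 < b)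
    (hN : N = 2 ∨ N = 3) (hf : Continuous f) {ζ : ℝ} (hζ : 0 < primitive f ζ) (hζ0 : 0 < ζ)
    {φ ψ : Space N → ℝ} (hφ : IsRadialTest φ) (hψ : IsRadialTest ψ) (hφ0 : 0 < potential f φ)
    (hψ0 : 0 < potential f ψ) : EventuallyJoined a b f φ ψ := by
  obtain ⟨R, hR0, hR⟩ := hφ.exists_support_radius
  obtain ⟨R', hR0', hR'⟩ := hψ.exists_support_radius
  obtain ⟨K, hK⟩ := exists_le_potential_smul hf hφ
  obtain ⟨K', hK'⟩ := exists_le_potential_smul hf hψ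
  -- Both supports lie inside radius r, so a single plateau beyond it is an intermediate stop for φ
  -- and for ψ.
  set r : ℝ := max (max R R') 1
  have hr1 : 1 ≤ r := le_max_right _ _
  have hp : ∀ x : Space N, r ^ 2 ≤ ‖x‖ ^ 2 → r ≤ ‖x‖ := fun x hx =>
    (sq_le_sq₀ (by linarith) (norm_nonneg x)).1 hx
  set β : ℝ := min (potential f φ) (potential f ψ) / 2
  have hβ : 0 < β := by positivity
  have hβ2 : 2 * β = min (potential f φ) (potential f ψ) := mul_div_cancel₀ _ two_ne_zero
  obtain ⟨Q, δ, hQ, hδ, h1, h2⟩ := exists_plateau (N := N) (by omega) hf hζ hζ0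
    (one_le_pow₀ hr1 : 1 ≤ r ^ 2) hβ (max K K' + 1)
  have e1 := eventuallyJoined_plateau ha hb hN hf hφ hδ hQ
    (fun x hx => hR x ((le_max_left _ _).trans ((le_max_left _ _).trans (hp x hx)))) hβ
    (hβ2.trans_le (min_le_left _ _)) hK h1
    (by linarith [le_max_left K K'])
  have e2 := eventuallyJoined_plateau ha hb hN hf hψ hδ hQ
    (fun x hx => hR' x ((le_max_right _ _).trans ((le_max_left _ _).trans (hp x hx)))) hβ
    (hβ2.trans_le (min_le_right _ _)) hK' h1
    (by linarith [le_max_right K K'])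
  exact e1.trans ((isRadialTest_plateau _ _ hδ).smul ζ) e2.symm

/-- Any two radial test functions in the negative sublevel set are joined there. -/
lemma joinedIn_of_isRadialTest (ha : 0 ≤ a) (hb : 0 < b) (hN : N = 2 ∨ N = 3)
    (hf : Continuous f) {ζ : ℝ} (hζ : 0 < primitive f ζ) (hζ0 : 0 < ζ)
    {φ ψ : Space N → ℝ} (hφ : IsRadialTest φ) (hψ : IsRadialTest ψ)
    (hφ0 : hφ.toH1r ∈ negativeSublevel N a b f) (hψ0 : hψ.toH1r ∈ negativeSublevel N a b f) :
    JoinedIn (negativeSublevel N a b f) hφ.toH1r hψ.toH1r := by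
  have hpos : ∀ {χ : Space N → ℝ} (h : IsRadialTest χ), h.toH1r ∈ negativeSublevel N a b f →
      0 < potential f χ := fun {χ} h hχ => by
    rw [toH1r_mem_negativeSublevel] at hχ
    refine lt_of_le_of_lt ?_ hχ
    have := dirichlet_nonneg χ
    positivity
  obtain ⟨S₀, hS⟩ := eventuallyJoined_of_potential_pos_of_potential_pos ha hb hN hf hζ hζ0 hφ hψ
    (hpos hφ hφ0) (hpos hψ hψ0)
  have hS1 : 1 ≤ max S₀ 1 := le_max_right _ _
  have hne : (max S₀ 1)⁻¹ ≠ 0 := inv_ne_zero (by linarith)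
  exact (joinedIn_dilation ha hb hN hφ hφ0 hS1 (hφ.comp_smul hne)).trans
    ((hS _ (le_max_left _ _) _ (hψ.comp_smul hne)).trans
      (joinedIn_dilation ha hb hN hψ hψ0 hS1 _).symm)

lemma nonempty_negativeSublevel (ha : 0 ≤ a) (hb : 0 < b) (hN : N = 2 ∨ N = 3)
    (hf : Continuous f) {ζ : ℝ} (hζ : 0 < primitive f ζ) (hζ0 : 0 < ζ) :
    (negativeSublevel N a b f).Nonempty := by
  obtain ⟨Q, δ, -, hδ, -, h⟩ := exists_plateau (N := N) (by omega) hf hζ hζ0 le_rfl one_pos 1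
  have ht : IsRadialTest (fun x : Space N => ζ * plateau 1 Q δ x) :=
    (isRadialTest_plateau 1 Q hδ).smul ζ
  -- A path from a dilated plateau to itself inside the sublevel shows in particular that this
  -- plateau belongs to it.
  obtain ⟨S₀, hS⟩ := eventuallyJoined_of_potential_pos_of_potential_pos ha hb hN hf hζ hζ0 ht ht
    (one_pos.trans_le h) (one_pos.trans_le h)
  have hne : (max S₀ 1)⁻¹ ≠ 0 := inv_ne_zero (by linarith [le_max_right S₀ 1])
  exact ⟨_, (hS _ (le_max_left _ _) (ht.comp_smul hne) (ht.comp_smul hne)).source_mem⟩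

end

/-! ### Mollification by radial kernels and the product rule for weak gradients -/

section

variable {N : ℕ}

section Mollification

variable {E : Type*} [NormedAddCommGroup E]

/-- Continuity of translations in L², obtained from the continuity of composition with measure
preserving maps. -/
lemma exists_forall_eLpNorm_translate_sub_le {h : Space N → E} (hh : MemLp h 2) {ε : ℝ≥0∞}
    (hε : ε ≠ 0) : ∃ δ > 0, ∀ y : Space N, ‖y‖ < δ → eLpNorm (fun x => h (x - y) - h x) 2 ≤ ε := by
  let g : C(Space N, C(Space N, Space N)) :=
    ContinuousMap.curry ⟨fun p => p.2 - p.1, by fun_prop⟩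
  have hg : ∀ y, MeasurePreserving (g y) (volume : Measure (Space N)) volume := fun y =>
    measurePreserving_sub_right volume y
  have hc : Continuous fun y => Lp.compMeasurePreserving (g y) (hg y) (hh.toLp h) :=
    Continuous.compMeasurePreservingLp continuous_const g.continuous hg (by simp)
  have h0 := hc.tendsto 0
  rw [EMetric.tendsto_nhds] at h0
  obtain ⟨δ, hδ, hball⟩ := Metric.eventually_nhds_iff.1 (h0 ε (pos_iff_ne_zero.2 hε))
  refine ⟨δ, hδ, fun y hy => ?_⟩
  have h1 := hball (by simpa using hy : dist y 0 < δ)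
  rw [Lp.edist_def] at h1
  refine le_of_eq_of_le (eLpNorm_congr_ae ?_) h1.le
  have e : ∀ y, Lp.compMeasurePreserving (g y) (hg y) (hh.toLp h)
      =ᵐ[volume] fun x => h (x - y) := fun y =>
    (Lp.coeFn_compMeasurePreserving _ (hg y)).trans
      ((hg y).quasiMeasurePreserving.ae_eq_comp hh.coeFn_toLp)
  filter_upwards [e y, e 0] with x h1 h2
  rw [Pi.sub_apply, h1, h2, sub_zero]

variable [NormedSpace ℝ E]

/-- The convolution `∫ η(x - t) h(t) dt`. -/
def mollify (η : Space N → ℝ) (h : Space N → E) (x : Space N) : E := ∫ t, η (x - t) • h t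

/-- With η dy read as a probability measure, the error is the average of h(x - y) - h(x). Its square
is at most the average of the squares, and Tonelli reduces the claim to single translations. -/
lemma eLpNorm_mollify_sub_le [CompleteSpace E] {η : Space N → ℝ} (hη : Continuous η)
    (hηc : HasCompactSupport η)
    (hη0 : ∀ y, 0 ≤ η y) (hη1 : ∫ y, η y = 1) {h : Space N → E} (hm : StronglyMeasurable h)
    (hh : MemLp h 2) {c : ℝ≥0∞}
    (hc : ∀ y, η y ≠ 0 → eLpNorm (fun x => h (x - y) - h x) 2 ≤ c) :
    eLpNorm (fun x => mollify η h x - h x) 2 ≤ c := by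
  have hηi : Integrable η := hη.integrable_of_hasCompactSupport hηc
  let ν : Measure (Space N) := volume.withDensity fun y => ENNReal.ofReal (η y)
  have hηm : Measurable fun y => ENNReal.ofReal (η y) := hη.measurable.ennreal_ofReal
  have hν : IsProbabilityMeasure ν := ⟨by
    rw [withDensity_apply _ MeasurableSet.univ, Measure.restrict_univ,
      ← ofReal_integral_eq_lintegral_ofReal hηi (ae_of_all _ hη0), hη1, ENNReal.ofReal_one]⟩
  have hloc : LocallyIntegrable h := hh.locallyIntegrable (by norm_num)
  have key : ∀ x, ‖mollify η h x - h x‖ₑ ^ 2 ≤ ∫⁻ y, ‖h (x - y) - h x‖ₑ ^ 2 ∂ν := fun x => by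
    have hint : Integrable fun t => η (x - t) • h t := by
      refine hloc.integrable_smul_left_of_hasCompactSupport (by fun_prop) ?_
      exact hηc.comp_homeomorph (Homeomorph.subLeft x)
    have hint' : Integrable fun y => η y • h (x - y) := by
      simpa using hint.comp_sub_left x
    have e1 : mollify η h x - h x = ∫ y, (h (x - y) - h x) ∂ν := by
      rw [integral_withDensity_eq_integral_toReal_smul hηm (ae_of_all _ fun _ => by simp)]
      simp_rw [ENNReal.toReal_ofReal (hη0 _), smul_sub]
      rw [integral_sub hint' (hηi.smul_const _), integral_smul_const, hη1, one_smul, mollify,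
        ← integral_sub_left_eq_self (fun t => η (x - t) • h t) volume x]
      simp
    have hmx : AEStronglyMeasurable (fun y => h (x - y) - h x) ν :=
      ((hm.comp_measurable (measurable_const.sub measurable_id)).sub
        stronglyMeasurable_const).aestronglyMeasurable
    have e2 := eLpNorm_le_eLpNorm_of_exponent_le (p := 1) (q := 2) (by norm_num) hmx
    rw [eLpNorm_one_eq_lintegral_enorm] at e2
    have e3 : ‖mollify η h x - h x‖ₑ ≤ eLpNorm (fun y => h (x - y) - h x) 2 ν := by
      rw [e1]
      exact (enorm_integral_le_lintegral_enorm _).trans e2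
    refine (pow_le_pow_left₀ (zero_le) e3 2).trans_eq ?_
    have := eLpNorm_nnreal_pow_eq_lintegral (f := fun y => h (x - y) - h x) (μ := ν) (p := 2)
      (by norm_num)
    simpa using this
  have hsq : ∀ w : Space N → E, eLpNorm w 2 ^ 2 = ∫⁻ x, ‖w x‖ₑ ^ 2 := fun w => by
    have := eLpNorm_nnreal_pow_eq_lintegral (f := w) (μ := volume) (p := 2) (by norm_num)
    simpa using this
  refine (ENNReal.pow_le_pow_left_iff two_ne_zero).1 ?_
  rw [hsq]
  calc ∫⁻ x, ‖mollify η h x - h x‖ₑ ^ 2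
      ≤ ∫⁻ x, ∫⁻ y, ‖h (x - y) - h x‖ₑ ^ 2 ∂ν := lintegral_mono key
    _ = ∫⁻ y, (∫⁻ x, ‖h (x - y) - h x‖ₑ ^ 2) ∂ν := by
        refine lintegral_lintegral_swap ?_
        refine (Measurable.pow_const (StronglyMeasurable.enorm ?_) 2).aemeasurable
        exact (hm.comp_measurable (measurable_fst.sub measurable_snd)).sub
          (hm.comp_measurable measurable_fst)
    _ ≤ ∫⁻ _, c ^ 2 ∂ν := by
        refine lintegral_mono_ae ?_
        have : ∀ᵐ y ∂ν, η y ≠ 0 := by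
          refine (ae_withDensity_iff hηm).2 (ae_of_all _ fun y hy h0 => hy ?_)
          rw [h0, ENNReal.ofReal_zero]
        filter_upwards [this] with y hy
        rw [← hsq]
        exact pow_le_pow_left₀ zero_le (hc y hy) 2
    _ = c ^ 2 := by simp

end Mollification

lemma exists_isRadialTest_bump {δ : ℝ} (hδ : 0 < δ) : ∃ η : Space N → ℝ, IsRadialTest η ∧
    (∀ y, 0 ≤ η y) ∧ (∫ y, η y = 1) ∧ ∀ y, η y ≠ 0 → ‖y‖ < δ := by
  have hδ2 : 0 < δ ^ 2 := by positivity
  -- With the negative inner threshold -δ² the inner factor is identically 1, so the plateau is a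
  -- bump centred at the origin.
  obtain ⟨κ, hκ⟩ : ∃ κ : Space N → ℝ, κ = plateau (-δ ^ 2) (δ ^ 2) (δ ^ 2) := ⟨_, rfl⟩
  have hκt : IsRadialTest κ := hκ ▸ isRadialTest_plateau _ _ hδ2
  have hκ0 : ∀ y, 0 ≤ κ y := fun y => hκ ▸ plateau_nonneg _ _ _ y
  have hκ1 : κ 0 = 1 := by
    rw [hκ]
    exact plateau_eq_one hδ2 (by simp) (by simp)
  have hpos : 0 < ∫ y, κ y :=
    hκt.contDiff.continuous.integral_pos_of_hasCompactSupport_nonneg_nonzero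
      hκt.hasCompactSupport hκ0 (x := 0) (by rw [hκ1]; exact one_ne_zero)
  refine ⟨fun x => (∫ y, κ y)⁻¹ * κ x, hκt.smul _,
    fun y => mul_nonneg (inv_nonneg.2 hpos.le) (hκ0 y), ?_, fun y hy => ?_⟩
  · rw [integral_const_mul, inv_mul_cancel₀ hpos.ne']
  · by_contra! hle
    refine hy ?_
    have : κ y = 0 := by
      rw [hκ]
      exact plateau_eq_zero_of_ge hδ2 (pow_le_pow_left₀ hδ.le hle 2)
    simp only [this, mul_zero]

lemma exists_linearIsometryEquiv_apply_eq {x y : Space N} (h : ‖x‖ = ‖y‖) :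
    ∃ Q : Space N ≃ₗᵢ[ℝ] Space N, Q x = y :=
  ⟨(ℝ ∙ (x - y))ᗮ.reflection, Submodule.reflection_sub h⟩

/-- A reflection carries x to y, and it preserves the measure, η, and h almost everywhere. -/
lemma mollify_radial {η : Space N → ℝ} (hη : ∀ x y, ‖x‖ = ‖y‖ → η x = η y)
    {h : Space N → ℝ} {ρ : ℝ → ℝ} (hh : ∀ᵐ x, h x = ρ ‖x‖) {x y : Space N} (hxy : ‖x‖ = ‖y‖) :
    mollify η h x = mollify η h y := by
  obtain ⟨Q, rfl⟩ := exists_linearIsometryEquiv_apply_eq hxy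
  have hQ := Q.measurePreserving
  rw [mollify, mollify, ← hQ.integral_comp Q.toHomeomorph.measurableEmbedding
    (fun t => η (Q x - t) • h t)]
  refine integral_congr_ae ?_
  filter_upwards [hh, hQ.quasiMeasurePreserving.ae hh] with t h1 h2
  rw [h1, h2, Q.norm_map, ← map_sub, hη (Q (x - t)) (x - t) (Q.norm_map _)]

lemma mollify_eq_convolution (η h : Space N → ℝ) :
    mollify η h = convolution h η (ContinuousLinearMap.mul ℝ ℝ) volume := by
  ext x
  simp [mollify, convolution_def, mul_comm]

/-- The derivative falls on η, and the weak gradient is tested against t ↦ η(x - t); the chain-rule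
sign cancels the sign of integration by parts. -/
lemma gradient_mollify {η : Space N → ℝ} (hη : ContDiff ℝ ∞ η) (hηc : HasCompactSupport η)
    {u : Space N → ℝ} {g : Space N → Space N} (hu : LocallyIntegrable u)
    (hg : LocallyIntegrable g) (h : HasWeakGradient u g) :
    gradient (mollify η u) = mollify η g := by
  ext1 x
  refine ext_inner_right ℝ fun v => ?_
  rw [inner_gradient, mollify_eq_convolution,
    (hηc.hasFDerivAt_convolution_right _ hu (hη.of_le (by simp)) x).fderiv,
    convolution_precompR_apply _ hu (hηc.fderiv ℝ) (hη.continuous_fderiv (by simp)),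
    convolution_def]
  have hφ : ContDiff ℝ ∞ fun t => η (x - t) := hη.comp (contDiff_const.sub contDiff_id)
  have hφc : HasCompactSupport fun t => η (x - t) :=
    hηc.comp_homeomorph (Homeomorph.subLeft x)
  have h1 := h _ hφ hφc v
  have h2 : ∀ t, fderiv ℝ (fun t => η (x - t)) t v = - fderiv ℝ η (x - t) v := fun t => by
    have h3 := ((hη.differentiable (by simp) (x - t)).hasFDerivAt).comp t
      ((hasFDerivAt_id t).const_sub x)
    have h4 : HasFDerivAt (fun t => η (x - t)) _ t := h3
    rw [h4.fderiv]
    simp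
  have hint : Integrable fun t => η (x - t) • g t :=
    hg.integrable_smul_left_of_hasCompactSupport hφ.continuous hφc
  simp_rw [h2, mul_neg, integral_neg, neg_inj] at h1
  rw [mollify, real_inner_comm, ← integral_inner hint]
  simpa [real_inner_smul_right, real_inner_comm v] using h1

lemma isRadialTest_mollify {η : Space N → ℝ} (hη : IsRadialTest η) {u : Space N → ℝ}
    (hu : LocallyIntegrable u) (huc : HasCompactSupport u) {ρ : ℝ → ℝ}
    (hρ : ∀ᵐ x, u x = ρ ‖x‖) : IsRadialTest (mollify η u) where
  contDiff := by
    rw [mollify_eq_convolution]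
    exact hη.hasCompactSupport.contDiff_convolution_right (n := ⊤) _ hu hη.contDiff
  hasCompactSupport := by
    rw [mollify_eq_convolution]
    exact huc.convolution _ hη.hasCompactSupport
  radial _ _ hxy := mollify_radial hη.radial hρ hxy

lemma norm_mkH1_sub_mkH1_le {u u' : Space N → ℝ} {g g' : Space N → Space N} (hu : MemLp u 2)
    (hg : MemLp g 2) (h : HasWeakGradient u g) (hu' : MemLp u' 2) (hg' : MemLp g' 2)
    (h' : HasWeakGradient u' g') :
    ‖mkH1 hu hg h - mkH1 hu' hg' h'‖
      ≤ (eLpNorm (u - u') 2).toReal + (eLpNorm (g - g') 2).toReal := by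
  set w := mkH1 hu hg h - mkH1 hu' hg' h'
  have h1 : ‖fn w‖ = (eLpNorm (u - u') 2).toReal := by
    rw [← Lp.norm_toLp (u - u') (hu.sub hu'), MemLp.toLp_sub hu hu']
    rfl
  have h2 : ‖weakGrad w‖ = (eLpNorm (g - g') 2).toReal := by
    rw [← Lp.norm_toLp (g - g') (hg.sub hg'), MemLp.toLp_sub hg hg']
    rfl
  rw [← h1, ← h2]
  refine abs_le_of_sq_le_sq' ?_ (by positivity) |>.2
  rw [H1_norm_sq_eq]
  nlinarith [norm_nonneg (fn w), norm_nonneg (weakGrad w)]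

/-- The weak gradient of u is tested against χφ, and the ordinary product rule rearranges the
outcome. -/
lemma hasWeakGradient_mul {χ u : Space N → ℝ} {g : Space N → Space N} (hχ : ContDiff ℝ ∞ χ)
    (hu : LocallyIntegrable u) (hg : LocallyIntegrable g) (h : HasWeakGradient u g) :
    HasWeakGradient (fun x => χ x * u x) (fun x => χ x • g x + u x • gradient χ x) := by
  intro φ hφ hφc v
  have h1 := h (fun x => χ x * φ x) (hχ.mul hφ) hφc.mul_left v
  have hd : ∀ x, fderiv ℝ (fun x => χ x * φ x) x v
      = χ x * fderiv ℝ φ x v + φ x * fderiv ℝ χ x v := fun x => by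
    rw [fderiv_fun_mul (hχ.differentiable (by simp) x) (hφ.differentiable (by simp) x)]
    simp
  have c1 : Continuous fun x => fderiv ℝ φ x v :=
    (hφ.continuous_fderiv (by simp)).clm_apply continuous_const
  have c2 : Continuous fun x => fderiv ℝ χ x v :=
    (hχ.continuous_fderiv (by simp)).clm_apply continuous_const
  have s1 : HasCompactSupport fun x => fderiv ℝ φ x v := hφc.fderiv_apply ℝ v
  have i1 : Integrable fun x => u x * (χ x * fderiv ℝ φ x v) :=
    hu.integrable_smul_right_of_hasCompactSupport (hχ.continuous.mul c1) s1.mul_left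
  have i2 : Integrable fun x => u x * (φ x * fderiv ℝ χ x v) :=
    hu.integrable_smul_right_of_hasCompactSupport (hφ.continuous.mul c2) hφc.mul_right
  have i3 : Integrable fun x => (χ x * φ x) * inner ℝ (g x) v := by
    have := (hg.integrable_smul_left_of_hasCompactSupport (hχ.continuous.mul hφ.continuous)
      hφc.mul_left).inner_const (𝕜 := ℝ) v
    simpa [real_inner_smul_left] using this
  simp_rw [hd, mul_add] at h1
  rw [integral_add i1 i2] at h1
  have e1 : ∫ x, χ x * u x * fderiv ℝ φ x v = ∫ x, u x * (χ x * fderiv ℝ φ x v) := by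
    congr 1
    ext x
    ring
  have e2 : ∫ x, φ x * inner ℝ (χ x • g x + u x • gradient χ x) v
      = (∫ x, (χ x * φ x) * inner ℝ (g x) v) + ∫ x, u x * (φ x * fderiv ℝ χ x v) := by
    rw [← integral_add i3 i2]
    congr 1
    ext x
    rw [inner_add_left, real_inner_smul_left, real_inner_smul_left, inner_gradient]
    ring
  rw [e1, e2]
  linarith

end

/-! ### Cutoffs and density of radial test functions -/

section

variable {N : ℕ}

lemma exists_norm_gradient_le {χ : Space N → ℝ} (h : IsRadialTest χ) :
    ∃ C, 0 ≤ C ∧ ∀ x, ‖gradient χ x‖ ≤ C := by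
  obtain ⟨C, hC⟩ := (continuous_gradient h.contDiff).bounded_above_of_compact_support
    (hasCompactSupport_gradient h.hasCompactSupport)
  exact ⟨C, (norm_nonneg _).trans (hC 0), hC⟩

lemma memLp_mul_isRadialTest {χ : Space N → ℝ} (h : IsRadialTest χ) {u : Space N → ℝ}
    (hu : MemLp u 2) : MemLp (fun x => χ x * u x) 2 := by
  obtain ⟨C, hC⟩ := h.contDiff.continuous.bounded_above_of_compact_support h.hasCompactSupport
  refine MemLp.of_le_mul (c := C) hu
    (h.contDiff.continuous.aestronglyMeasurable.mul hu.aestronglyMeasurable)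
    (ae_of_all _ fun x => ?_)
  rw [norm_mul]
  exact mul_le_mul_of_nonneg_right (hC x) (norm_nonneg _)

lemma memLp_smul_gradient {χ : Space N → ℝ} (h : IsRadialTest χ) {u : Space N → ℝ}
    (hu : MemLp u 2) {g : Space N → Space N} (hg : MemLp g 2) :
    MemLp (fun x => χ x • g x + u x • gradient χ x) 2 := by
  obtain ⟨C, hC⟩ := h.contDiff.continuous.bounded_above_of_compact_support h.hasCompactSupport
  obtain ⟨D, -, hD⟩ := exists_norm_gradient_le h
  refine MemLp.add (f := fun x => χ x • g x) (g := fun x => u x • gradient χ x) ?_ ?_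
  · refine MemLp.of_le_mul (c := C) hg
      (h.contDiff.continuous.aestronglyMeasurable.smul hg.aestronglyMeasurable)
      (ae_of_all _ fun x => ?_)
    rw [norm_smul]
    exact mul_le_mul_of_nonneg_right (hC x) (norm_nonneg _)
  · refine MemLp.of_le_mul (c := D) hu
      (hu.aestronglyMeasurable.smul (continuous_gradient h.contDiff).aestronglyMeasurable)
      (ae_of_all _ fun x => ?_)
    rw [norm_smul, mul_comm]
    exact mul_le_mul_of_nonneg_right (hD x) (norm_nonneg _)

/-- Multiplication of an `H¹` function by a radial test function. -/
def mulTest {χ : Space N → ℝ} (h : IsRadialTest χ) (u : H1 N) : H1 N :=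
  mkH1 (memLp_mul_isRadialTest h (Lp.memLp (fn u)))
    (memLp_smul_gradient h (Lp.memLp (fn u)) (Lp.memLp (weakGrad u)))
    (hasWeakGradient_mul h.contDiff ((Lp.memLp (fn u)).locallyIntegrable (by norm_num))
      ((Lp.memLp (weakGrad u)).locallyIntegrable (by norm_num)) u.2)

/-- Smooth truncations of `u ∈ H¹` converge to `u`. -/
lemma exists_mulTest_norm_sub_lt (u : H1 N) {ε : ℝ} (hε : 0 < ε) :
    ∃ (χ : Space N → ℝ) (h : IsRadialTest χ), ‖u - mulTest h u‖ < ε := by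
  obtain ⟨χ, hχ⟩ : ∃ χ : Space N → ℝ, χ = plateau (-1) 2 1 := ⟨_, rfl⟩
  have hχt : IsRadialTest χ := hχ ▸ isRadialTest_plateau _ _ one_pos
  have hχ0 : ∀ y, 0 ≤ χ y := fun y => hχ ▸ plateau_nonneg _ _ _ y
  have hχ1 : ∀ y, χ y ≤ 1 := fun y => hχ ▸ plateau_le_one _ _ _ y
  have hχe : ∀ y, ‖y‖ ≤ 1 → χ y = 1 := fun y hy => by
    rw [hχ]
    refine plateau_eq_one one_pos (by simp) ?_
    have := pow_le_one₀ (n := 2) (norm_nonneg y) hy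
    linarith
  obtain ⟨D, hD0, hD⟩ := exists_norm_gradient_le hχt
  let c : ℕ → ℝ := fun n => ((n : ℝ) + 1)⁻¹
  have hc0 : ∀ n, 0 < c n := fun n => by positivity
  have hc1 : ∀ n, c n ≤ 1 := fun n => inv_le_one_of_one_le₀ (by simp)
  -- The cutoff is eventually 1 on a neighbourhood of x, not only at x, so its gradient at x is
  -- eventually zero as well. With the uniform bound D this suffices for dominated convergence.
  have hct : ∀ x : Space N, ∀ᶠ n in atTop, ∀ᶠ y in 𝓝 x, χ (c n • y) = 1 := fun x => by
    obtain ⟨n₀, hn₀⟩ := exists_nat_ge (‖x‖ + 1)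
    filter_upwards [eventually_ge_atTop n₀] with n hn
    filter_upwards [Metric.ball_mem_nhds x one_pos] with y hy
    refine hχe _ ?_
    rw [norm_smul, Real.norm_of_nonneg (hc0 n).le, inv_mul_le_iff₀ (by positivity), mul_one]
    have h1 : ‖y‖ ≤ ‖x‖ + 1 := by
      have := norm_le_norm_add_norm_sub' y x
      rw [mem_ball_iff_norm] at hy
      linarith
    have h2 : (n₀ : ℝ) ≤ n := by exact_mod_cast hn
    linarith
  have ht : ∀ n, IsRadialTest fun x => χ (c n • x) := fun n => hχt.comp_smul (hc0 n).ne'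
  have hg : ∀ n x, ‖gradient (fun x => χ (c n • x)) x‖ ≤ D := fun n x => by
    rw [gradient_comp_smul, norm_smul, Real.norm_of_nonneg (hc0 n).le]
    exact (mul_le_of_le_one_left (norm_nonneg _) (hc1 n)).trans (hD _)
  have hlim : Tendsto (fun n => ‖u - mulTest (ht n) u‖ ^ 2) atTop (𝓝 (0 + 0)) := by
    simp_rw [mulTest, norm_sub_mkH1_sq]
    refine Tendsto.add ?_ ?_
    · rw [← integral_zero (Space N) ℝ]
      refine tendsto_integral_of_dominated_convergence (fun x => ‖fn u x‖ ^ 2) (fun n => ?_)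
        ((Lp.memLp (fn u)).integrable_norm_pow two_ne_zero) (fun n => ?_) ?_
      · exact (((Lp.memLp (fn u)).sub (memLp_mul_isRadialTest (ht n)
          (Lp.memLp (fn u)))).aestronglyMeasurable.norm.pow 2)
      · refine ae_of_all _ fun x => ?_
        rw [Real.norm_of_nonneg (by positivity)]
        have e : fn u x - χ (c n • x) * fn u x = (1 - χ (c n • x)) * fn u x := by ring
        rw [e, norm_mul]
        refine pow_le_pow_left₀ (by positivity) (mul_le_of_le_one_left (norm_nonneg _) ?_) 2
        rw [Real.norm_of_nonneg (by linarith [hχ1 (c n • x)])]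
        linarith [hχ0 (c n • x)]
      · refine ae_of_all _ fun x => tendsto_const_nhds.congr' ?_
        filter_upwards [hct x] with n hn
        rw [hn.self_of_nhds]
        simp
    · rw [← integral_zero (Space N) ℝ]
      refine tendsto_integral_of_dominated_convergence
        (fun x => 2 * ‖weakGrad u x‖ ^ 2 + 2 * D ^ 2 * ‖fn u x‖ ^ 2) (fun n => ?_)
        ((((Lp.memLp (weakGrad u)).integrable_norm_pow two_ne_zero).const_mul _).add
          (((Lp.memLp (fn u)).integrable_norm_pow two_ne_zero).const_mul _)) (fun n => ?_) ?_
      · exact (((Lp.memLp (weakGrad u)).sub (memLp_smul_gradient (ht n)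
          (Lp.memLp (fn u)) (Lp.memLp (weakGrad u)))).aestronglyMeasurable.norm.pow 2)
      · refine ae_of_all _ fun x => ?_
        rw [Real.norm_of_nonneg (by positivity)]
        have e : weakGrad u x - (χ (c n • x) • weakGrad u x
            + fn u x • gradient (fun x => χ (c n • x)) x)
            = (1 - χ (c n • x)) • weakGrad u x - fn u x • gradient (fun x => χ (c n • x)) x := by
          rw [sub_smul, one_smul, sub_sub]
        have h1 : ‖weakGrad u x - (χ (c n • x) • weakGrad u x
            + fn u x • gradient (fun x => χ (c n • x)) x)‖
            ≤ ‖weakGrad u x‖ + D * ‖fn u x‖ := by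
          rw [e]
          refine (norm_sub_le _ _).trans (add_le_add ?_ ?_)
          · rw [norm_smul]
            refine mul_le_of_le_one_left (norm_nonneg _) ?_
            rw [Real.norm_of_nonneg (by linarith [hχ1 (c n • x)])]
            linarith [hχ0 (c n • x)]
          · rw [norm_smul, mul_comm]
            exact mul_le_mul_of_nonneg_right (hg n x) (norm_nonneg _)
        refine (pow_le_pow_left₀ (norm_nonneg _) h1 2).trans ?_
        nlinarith [sq_nonneg (‖weakGrad u x‖ - D * ‖fn u x‖)]
      · refine ae_of_all _ fun x => tendsto_const_nhds.congr' ?_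
        filter_upwards [hct x] with n hn
        have h1 : gradient (fun x => χ (c n • x)) x = 0 := by
          have : (fun x => χ (c n • x)) =ᶠ[𝓝 x] fun _ => 1 := hn
          rw [gradient, this.fderiv_eq]
          simp
        rw [hn.self_of_nhds, h1]
        simp
  rw [add_zero] at hlim
  obtain ⟨n, hn⟩ := (hlim.eventually_lt_const (by positivity : 0 < ε ^ 2)).exists
  exact ⟨_, ht n, lt_of_pow_lt_pow_left₀ 2 hε.le hn⟩

/-- Radial test functions are dense in `H¹_r`. -/
theorem exists_isRadialTest_norm_sub_lt (u : H1r N) {ε : ℝ} (hε : 0 < ε) :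
    ∃ (φ : Space N → ℝ) (h : IsRadialTest φ), ‖u - h.toH1r‖ < ε := by
  obtain ⟨χ, hχ, hlt⟩ := exists_mulTest_norm_sub_lt (u : H1 N) (half_pos hε)
  obtain ⟨ρ, hρ⟩ := u.2
  obtain ⟨σ, hσ⟩ := exists_radial_profile hχ.radial
  set w : H1 N := (u : H1 N)
  have hw : MemLp (fun x => χ x * fn w x) 2 := memLp_mul_isRadialTest hχ (Lp.memLp (fn w))
  have hG : MemLp (fun x => χ x • weakGrad w x + fn w x • gradient χ x) 2 :=
    memLp_smul_gradient hχ (Lp.memLp (fn w)) (Lp.memLp (weakGrad w))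
  have hwl : LocallyIntegrable (fun x => χ x * fn w x) := hw.locallyIntegrable (by norm_num)
  have hGl : LocallyIntegrable (fun x => χ x • weakGrad w x + fn w x • gradient χ x) :=
    hG.locallyIntegrable (by norm_num)
  have hweak := hasWeakGradient_mul hχ.contDiff
    ((Lp.memLp (fn w)).locallyIntegrable (by norm_num))
    ((Lp.memLp (weakGrad w)).locallyIntegrable (by norm_num)) w.2
  -- Error budget: less than ε / 2 for the truncation, then ε / 8 for mollifying the function and ε
  -- / 8 for its gradient.
  have hε4 : ENNReal.ofReal (ε / 8) ≠ 0 := by simpa using hε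
  obtain ⟨δ₁, hδ₁, h1⟩ := exists_forall_eLpNorm_translate_sub_le hw hε4
  obtain ⟨δ₂, hδ₂, h2⟩ := exists_forall_eLpNorm_translate_sub_le hG hε4
  obtain ⟨η, hη, hη0, hη1, hηδ⟩ := exists_isRadialTest_bump (N := N) (lt_min hδ₁ hδ₂)
  have e1 := eLpNorm_mollify_sub_le hη.contDiff.continuous hη.hasCompactSupport hη0 hη1
    (hχ.contDiff.continuous.stronglyMeasurable.mul (Lp.stronglyMeasurable (fn w))) hw
    fun y hy => h1 y ((hηδ y hy).trans_le (min_le_left _ _))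
  have e2 := eLpNorm_mollify_sub_le hη.contDiff.continuous hη.hasCompactSupport hη0 hη1
    ((hχ.contDiff.continuous.stronglyMeasurable.smul (Lp.stronglyMeasurable (weakGrad w))).add
      ((Lp.stronglyMeasurable (fn w)).smul
        (continuous_gradient hχ.contDiff).stronglyMeasurable)) hG
    fun y hy => h2 y ((hηδ y hy).trans_le (min_le_right _ _))
  -- Truncation precedes mollification so that the smooth approximation has compact support.
  have hφ : IsRadialTest (mollify η fun x => χ x * fn w x) := by
    refine isRadialTest_mollify hη hwl hχ.hasCompactSupport.mul_right
      (ρ := fun r => σ r * ρ r) ?_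
    filter_upwards [hρ] with x hx
    rw [hσ, ← hx]
  refine ⟨_, hφ, ?_⟩
  have hgrad := gradient_mollify hη.contDiff hη.hasCompactSupport hwl hGl hweak
  have hle : ∀ {t : ℝ≥0∞}, t ≤ ENNReal.ofReal (ε / 8) → t.toReal ≤ ε / 8 := fun {t} ht =>
    ENNReal.toReal_le_of_le_ofReal (by positivity) ht
  have hclose : ‖hφ.toH1 - mulTest hχ w‖ ≤ ε / 8 + ε / 8 := by
    refine (norm_mkH1_sub_mkH1_le _ _ _ _ _ _).trans (add_le_add (hle e1) (hle ?_))
    rw [hgrad]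
    exact e2
  have e3 : ‖u - hφ.toH1r‖ = ‖w - hφ.toH1‖ := rfl
  rw [e3]
  calc ‖w - hφ.toH1‖ = ‖(w - mulTest hχ w) - (hφ.toH1 - mulTest hχ w)‖ := by
        rw [sub_sub_sub_cancel_right]
    _ ≤ ‖w - mulTest hχ w‖ + ‖hφ.toH1 - mulTest hχ w‖ := norm_sub_le _ _
    _ < ε := by linarith

end

/-! ### Growth bounds and continuity of the energy -/

section

variable {N : ℕ} {f : ℝ → ℝ}

lemma BerestyckiLions.exists_abs_le_near_zero (hf : BerestyckiLions N f) :
    ∃ c δ : ℝ, 0 < δ ∧ ∀ t, |t| < δ → |f t| ≤ c * |t| := by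
  obtain ⟨m, hm0, hm⟩ := EReal.lt_iff_exists_real_btwn.1 hf.liminf_zero
  have h1 := eventually_lt_of_lt_liminf hm
  have h2 := eventually_lt_of_limsup_lt hf.limsup_zero
  obtain ⟨δ, hδ, h⟩ := Metric.eventually_nhds_iff.1 (eventually_nhdsWithin_iff.1 (h1.and h2))
  have h0 : f 0 = 0 := hf.odd.map_zero
  refine ⟨|m|, δ, hδ, fun t ht => ?_⟩
  rcases eq_or_ne t 0 with rfl | hne
  · simp [h0]
  obtain ⟨a1, a2⟩ := h (by simpa using ht : dist t 0 < δ) hne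
  have a1' : m < f t / t := by exact_mod_cast a1
  have a2' : f t / t < 0 := by exact_mod_cast a2
  have h3 : |f t / t| ≤ |m| := abs_le_abs_of_nonpos a2'.le a1'.le
  rwa [abs_div, div_le_iff₀ (abs_pos.2 hne)] at h3

/-- Near zero f is at most linear, at infinity the growth condition applies, and in between f is
bounded by compactness while w is at least δ. Oddness covers negative t. -/
lemma BerestyckiLions.exists_abs_le_mul (hf : BerestyckiLions N f) {w : ℝ → ℝ}
    (hw : ∀ t, |t| ≤ w |t|) (hev : ∀ᶠ t in atTop, |f t| ≤ w t) :
    ∃ C, 0 ≤ C ∧ ∀ t, |f t| ≤ C * w |t| := by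
  obtain ⟨c, δ, hδ, h0⟩ := hf.exists_abs_le_near_zero
  obtain ⟨T, hT⟩ := eventually_atTop.1 hev
  obtain ⟨K, hK⟩ := (isCompact_Icc.image_of_continuousOn
    hf.continuous.abs.continuousOn (s := Set.Icc δ T)).bddAbove
  have hC0 : 0 ≤ max (max c 1) (K / δ) := by
    exact zero_le_one.trans ((le_max_right _ _).trans (le_max_left _ _))
  have hwn : ∀ t, 0 ≤ w |t| := fun t => (abs_nonneg t).trans (hw t)
  have key : ∀ t, 0 ≤ t → |f t| ≤ max (max c 1) (K / δ) * w |t| := fun t ht => by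
    rcases lt_or_ge t δ with h1 | h1
    · refine (h0 t (by rwa [abs_of_nonneg ht])).trans ?_
      calc c * |t| ≤ max (max c 1) (K / δ) * |t| :=
            mul_le_mul_of_nonneg_right ((le_max_left _ _).trans (le_max_left _ _)) (abs_nonneg t)
        _ ≤ _ := mul_le_mul_of_nonneg_left (hw t) hC0
    rcases le_or_gt T t with h2 | h2
    · calc |f t| ≤ 1 * w |t| := by
            rw [one_mul, abs_of_nonneg ht]
            exact hT t h2
        _ ≤ _ := mul_le_mul_of_nonneg_right ((le_max_right _ _).trans (le_max_left _ _)) (hwn t)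
    · have h3 : |f t| ≤ K := hK (Set.mem_image_of_mem _ ⟨h1, h2.le⟩)
      have hK0 : 0 ≤ K := (abs_nonneg _).trans h3
      calc |f t| ≤ K / δ * δ := by rwa [div_mul_cancel₀ _ hδ.ne']
        _ ≤ K / δ * w |t| := mul_le_mul_of_nonneg_left
            (h1.trans ((le_abs_self t).trans (hw t))) (by positivity)
        _ ≤ _ := mul_le_mul_of_nonneg_right (le_max_right _ _) (hwn t)
  refine ⟨_, hC0, fun t => ?_⟩
  rcases le_total 0 t with ht | ht
  · exact key t ht
  · have := key (-t) (by linarith)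
    rwa [hf.odd t, abs_neg, abs_neg] at this

/-- Between s and t the integrand is at most C times w at max(|s|, |t|), and that value is one of
the two summands. -/
lemma abs_primitive_sub_le (hf : Continuous f) {w : ℝ → ℝ} {C : ℝ} (hC : 0 ≤ C)
    (hw0 : ∀ t, 0 ≤ w |t|) (hw : MonotoneOn w (Set.Ici 0)) (h : ∀ t, |f t| ≤ C * w |t|)
    (s t : ℝ) : |primitive f s - primitive f t| ≤ |s - t| * (C * w |s| + C * w |t|) := by
  have e : primitive f s - primitive f t = ∫ τ in t..s, f τ :=
    intervalIntegral.integral_interval_sub_left (hf.intervalIntegrable _ _)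
      (hf.intervalIntegrable _ _)
  rw [e, mul_comm]
  rw [← Real.norm_eq_abs (∫ τ in t..s, f τ)]
  refine intervalIntegral.norm_integral_le_of_norm_le_const fun τ hτ => ?_
  refine le_trans (h τ : ‖f τ‖ ≤ C * w |τ|) ?_
  rw [← mul_add]
  refine mul_le_mul_of_nonneg_left ?_ hC
  have hτ' : |τ| ≤ max |s| |t| := by
    rw [Set.mem_uIoc] at hτ
    rcases hτ with ⟨h1, h2⟩ | ⟨h1, h2⟩
    · rw [abs_le]
      constructor
      · linarith [le_max_right |s| |t|, neg_abs_le t]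
      · linarith [le_max_left |s| |t|, le_abs_self s]
    · rw [abs_le]
      constructor
      · linarith [le_max_left |s| |t|, neg_abs_le s]
      · linarith [le_max_right |s| |t|, le_abs_self t]
  have h1 : w |τ| ≤ w (max |s| |t|) :=
    hw (abs_nonneg τ) ((abs_nonneg s).trans (le_max_left _ _)) hτ'
  rcases max_choice |s| |t| with h2 | h2 <;> rw [h2] at h1 <;> linarith [hw0 s, hw0 t]

lemma norm_fn_le (u : H1 N) : ‖fn u‖ ≤ ‖u‖ := by
  refine abs_le_of_sq_le_sq' ?_ (norm_nonneg u) |>.2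
  rw [H1_norm_sq_eq]
  nlinarith [norm_nonneg (weakGrad u)]

lemma norm_weakGrad_le (u : H1 N) : ‖weakGrad u‖ ≤ ‖u‖ := by
  refine abs_le_of_sq_le_sq' ?_ (norm_nonneg u) |>.2
  rw [H1_norm_sq_eq]
  nlinarith [norm_nonneg (fn u)]

lemma norm_smul_H1r (c : ℝ) (u : H1r N) : ‖c • u‖ = |c| * ‖u‖ :=
  norm_smul c ((u : H1 N) : WithLp 2 (L2 N × L2Vec N))

/-- This is the form in which inequalities for test functions pass to all of `H1r`: pointwise bounds
directly, norm bounds by Fatou. -/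
lemma exists_seq_isRadialTest (u : H1r N) : ∃ (φ : ℕ → Space N → ℝ)
    (h : ∀ n, IsRadialTest (φ n)), Tendsto (fun n => ‖(h n).toH1r‖) atTop (𝓝 ‖u‖) ∧
      ∀ᵐ x, Tendsto (fun n => φ n x) atTop (𝓝 (fn (u : H1 N) x)) := by
  choose φ h hlt using fun n : ℕ =>
    exists_isRadialTest_norm_sub_lt u (Nat.one_div_pos_of_nat (α := ℝ) (n := n))
  have hlim : Tendsto (fun n => (h n).toH1r) atTop (𝓝 u) := by
    rw [tendsto_iff_norm_sub_tendsto_zero]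
    refine squeeze_zero (fun _ => norm_nonneg _) (fun n => ?_)
      tendsto_one_div_add_atTop_nhds_zero_nat
    rw [norm_sub_rev]
    exact (hlt n).le
  have hfn : Tendsto (fun n => fn (h n).toH1) atTop (𝓝 (fn (u : H1 N))) := by
    rw [tendsto_iff_norm_sub_tendsto_zero] at hlim ⊢
    exact squeeze_zero (fun _ => norm_nonneg _)
      (fun n => norm_fn_le ((h n).toH1 - (u : H1 N))) hlim
  obtain ⟨ns, hns, hae⟩ := (tendstoInMeasure_of_tendsto_Lp hfn).exists_seq_tendsto_ae
  refine ⟨fun n => φ (ns n), fun n => h (ns n),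
    (hlim.norm.comp hns.tendsto_atTop), ?_⟩
  filter_upwards [hae, ae_all_iff.2 fun n => (h n).fn_toH1] with x hx h1
  simpa [h1] using hx

/-- The bounds on a weight `w` that make `u ↦ ∫ F(u)` Lipschitz on the ball of radius `M`. -/
structure IsWeight (N : ℕ) (M : ℝ) (f w : ℝ → ℝ) (K : ℝ) : Prop where
  abs_sub_le : ∀ s t, |primitive f s - primitive f t| ≤ |s - t| * (w s + w t)
  integrable : ∀ u v : H1r N, ‖u‖ ≤ M →
    Integrable fun x => |fn (v : H1 N) x| * w (fn (u : H1 N) x)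
  integral_le : ∀ u v : H1r N, ‖u‖ ≤ M →
    ∫ x, |fn (v : H1 N) x| * w (fn (u : H1 N) x) ≤ K * ‖v‖

/-- The weight estimate reduces to a bound for `|v| w(u)` with `v` normalised. -/
lemma isWeight_of_le {M K : ℝ} {w : ℝ → ℝ} (hwc : Continuous w) (hw0 : ∀ t, 0 ≤ w t)
    (hsub : ∀ s t, |primitive f s - primitive f t| ≤ |s - t| * (w s + w t))
    (h : ∀ u v : H1r N, ‖u‖ ≤ M → ‖v‖ = 1 → ∃ G : Space N → ℝ, Integrable G ∧
      (∀ᵐ x, |fn (v : H1 N) x| * w (fn (u : H1 N) x) ≤ G x) ∧ ∫ x, G x ≤ K) :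
    IsWeight N M f w K := by
  have key : ∀ u v : H1r N, ‖u‖ ≤ M →
      (Integrable fun x => |fn (v : H1 N) x| * w (fn (u : H1 N) x)) ∧
      ∫ x, |fn (v : H1 N) x| * w (fn (u : H1 N) x) ≤ K * ‖v‖ := fun u v hu => by
    rcases eq_or_ne v 0 with rfl | hv
    · have : (fun x => |fn ((0 : H1r N) : H1 N) x| * w (fn (u : H1 N) x)) =ᵐ[volume] 0 := by
        filter_upwards [Lp.coeFn_zero ℝ 2 (volume : Measure (Space N))] with x hx
        have e : fn ((0 : H1r N) : H1 N) = 0 := rfl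
        rw [e, hx]
        simp
      rw [integrable_congr this, integral_congr_ae this]
      exact ⟨integrable_zero _ _ _, by simp⟩
    have hd : 0 < ‖v‖ := norm_pos_iff.2 hv
    obtain ⟨G, hG, hle, hK⟩ := h u (‖v‖⁻¹ • v) hu (by
      rw [norm_smul_H1r, abs_of_pos (inv_pos.2 hd), inv_mul_cancel₀ hd.ne'])
    have hb : ∀ᵐ x, |fn (v : H1 N) x| * w (fn (u : H1 N) x) ≤ ‖v‖ * G x := by
      filter_upwards [hle, Lp.coeFn_smul ‖v‖⁻¹ (fn (v : H1 N))] with x hx h1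
      have e : fn ((‖v‖⁻¹ • v : H1r N) : H1 N) = ‖v‖⁻¹ • fn (v : H1 N) := rfl
      rw [e, h1, Pi.smul_apply, smul_eq_mul, abs_mul, abs_of_pos (inv_pos.2 hd), mul_assoc,
        inv_mul_le_iff₀ hd] at hx
      exact hx
    have hm : AEStronglyMeasurable (fun x => |fn (v : H1 N) x| * w (fn (u : H1 N) x)) :=
      ((Lp.aestronglyMeasurable (fn (v : H1 N))).norm).mul
        (hwc.comp_aestronglyMeasurable (Lp.aestronglyMeasurable (fn (u : H1 N))))
    have hi : Integrable fun x => |fn (v : H1 N) x| * w (fn (u : H1 N) x) := by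
      refine (hG.const_mul ‖v‖).mono' hm ?_
      filter_upwards [hb] with x hx
      rwa [Real.norm_of_nonneg (mul_nonneg (abs_nonneg _) (hw0 _))]
    refine ⟨hi, (integral_mono_ae hi (hG.const_mul ‖v‖) hb).trans ?_⟩
    rw [integral_const_mul, mul_comm]
    exact mul_le_mul_of_nonneg_right hK hd.le
  exact ⟨hsub, fun u v hu => (key u v hu).1, fun u v hu => (key u v hu).2⟩

lemma integral_fn_sq_le (u : H1r N) {M : ℝ} (hu : ‖u‖ ≤ M) :
    ∫ x, fn (u : H1 N) x ^ 2 ≤ M ^ 2 := by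
  have h := norm_Lp_two_sq (fn (u : H1 N))
  simp only [Real.norm_eq_abs, sq_abs] at h
  rw [← h]
  exact pow_le_pow_left₀ (norm_nonneg _) ((norm_fn_le _).trans hu) 2

lemma integrable_fn_sq (u : H1 N) : Integrable fun x => fn u x ^ 2 :=
  (Lp.memLp (fn u)).integrable_sq

/-- If weights exist on all balls, `u ↦ ∫ F(u)` is continuous on `H¹_r`. -/
lemma continuous_integral_primitive (hf : Continuous f)
    (h : ∀ M, 0 < M → ∃ w K, IsWeight N M f w K) :
    Continuous fun u : H1r N => ∫ x, primitive f (fn (u : H1 N) x) := by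
  refine continuous_iff_continuousAt.2 fun u₀ => ?_
  obtain ⟨w, K, hw⟩ := h (‖u₀‖ + 1) (by positivity)
  have hint : ∀ u : H1r N, ‖u‖ ≤ ‖u₀‖ + 1 →
      Integrable fun x => primitive f (fn (u : H1 N) x) := fun u hu => by
    -- Comparison with F(0) = 0 gives |F(u)| ≤ |u| w(u) + |u| w(0).
    refine ((hw.integrable u u hu).add (hw.integrable 0 u ?_)).mono'
      ((continuous_primitive hf).comp_aestronglyMeasurable (Lp.aestronglyMeasurable _)) ?_
    · exact norm_zero.le.trans (by positivity)
    · filter_upwards [Lp.coeFn_zero ℝ 2 (volume : Measure (Space N))] with x hx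
      have e : fn (0 : H1 N) = 0 := rfl
      have := hw.abs_sub_le (fn (u : H1 N) x) 0
      rw [primitive_zero, sub_zero, sub_zero, mul_add] at this
      simpa [e, hx] using this
  have hlip : ∀ u : H1r N, ‖u‖ ≤ ‖u₀‖ + 1 →
      ‖(∫ x, primitive f (fn (u : H1 N) x)) - ∫ x, primitive f (fn (u₀ : H1 N) x)‖
        ≤ 2 * K * ‖u - u₀‖ := fun u hu => by
    have hu₀ : ‖u₀‖ ≤ ‖u₀‖ + 1 := by linarith
    rw [← integral_sub (hint u hu) (hint u₀ hu₀)]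
    have i1 := hw.integrable u (u - u₀) hu
    have i2 := hw.integrable u₀ (u - u₀) hu₀
    refine (norm_integral_le_of_norm_le (i1.add i2) ?_).trans ?_
    · filter_upwards [Lp.coeFn_sub (fn (u : H1 N)) (fn (u₀ : H1 N))] with x hx
      have e : fn ((u - u₀ : H1r N) : H1 N) = fn (u : H1 N) - fn (u₀ : H1 N) := rfl
      rw [e, Pi.add_apply, hx, ← mul_add]
      exact hw.abs_sub_le _ _
    · simp only [Pi.add_apply]
      rw [integral_add i1 i2]
      have := hw.integral_le u (u - u₀) hu
      have := hw.integral_le u₀ (u - u₀) hu₀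
      linarith
  rw [ContinuousAt, tendsto_iff_norm_sub_tendsto_zero]
  have hlim : Tendsto (fun u : H1r N => 2 * K * ‖u - u₀‖) (𝓝 u₀) (𝓝 0) := by
    have : Continuous fun u : H1r N => 2 * K * ‖u - u₀‖ := by fun_prop
    simpa using this.tendsto u₀
  refine squeeze_zero' (Eventually.of_forall fun _ => norm_nonneg _) ?_ hlim
  filter_upwards [Metric.ball_mem_nhds u₀ one_pos] with u hu
  refine hlip u ?_
  have h1 : ‖u - u₀‖ < 1 := mem_ball_iff_norm.1 hu
  have h2 : ‖u‖ ≤ ‖u₀‖ + ‖u - u₀‖ := norm_le_norm_add_norm_sub' u u₀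
  linarith

lemma isOpen_negativeSublevel (hf : Continuous f) (h : ∀ M, 0 < M → ∃ w K, IsWeight N M f w K)
    (a b : ℝ) : IsOpen (negativeSublevel N a b f) := by
  have h1 : Continuous fun u : H1r N => ∫ x, ‖weakGrad (u : H1 N) x‖ ^ 2 := by
    simp_rw [← norm_Lp_two_sq]
    refine (Continuous.norm ?_).pow 2
    refine (WithLp.prod_continuous_ofLp _ _ _).snd.comp
      (continuous_subtype_val.comp continuous_subtype_val)
  have h2 := continuous_integral_primitive hf h
  have h3 : Continuous fun u : H1r N => energy a b f (u : H1 N) := by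
    unfold energy
    exact ((continuous_const.mul h1).add (continuous_const.mul (h1.pow 2))).sub h2
  exact isOpen_lt h3 continuous_const

end

/-! ### Dimension three: Sobolev embedding -/

section

variable {N : ℕ} {f : ℝ → ℝ}

lemma eLpNorm_fderiv_le {φ : Space N → ℝ} (h : IsRadialTest φ) :
    eLpNorm (fderiv ℝ φ) 2 ≤ ENNReal.ofReal ‖h.toH1r‖ := by
  have h1 : eLpNorm (fderiv ℝ φ) 2 = eLpNorm (gradient φ) 2 :=
    eLpNorm_congr_norm_ae (ae_of_all _ fun x => (norm_gradient φ x).symm)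
  have h2 : ‖weakGrad h.toH1‖ = (eLpNorm (gradient φ) 2).toReal :=
    Lp.norm_toLp (gradient φ) (h.memLp_gradient 2)
  rw [h1, ← ENNReal.ofReal_toReal (h.memLp_gradient 2).2.ne, ← h2]
  exact ENNReal.ofReal_le_ofReal (norm_weakGrad_le h.toH1)

/-- The Sobolev inequality for radial functions in `H¹(ℝ³)`. -/
lemma exists_eLpNorm_six_le : ∃ S : NNReal, ∀ u : H1r 3,
    eLpNorm (fn (u : H1 3)) 6 ≤ S * ENNReal.ofReal ‖u‖ := by
  refine ⟨eLpNormLESNormFDerivOfEqInnerConst (volume : Measure (Space 3)) 2, fun u => ?_⟩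
  obtain ⟨φ, h, hlim, hae⟩ := exists_seq_isRadialTest u
  have hb : ∀ n, eLpNorm (φ n) 6 ≤
      eLpNormLESNormFDerivOfEqInnerConst (volume : Measure (Space 3)) 2 *
        ENNReal.ofReal ‖(h n).toH1r‖ := fun n => by
    have := eLpNorm_le_eLpNorm_fderiv_of_eq_inner (volume : Measure (Space 3))
      ((h n).contDiff.of_le (by simp)) (h n).hasCompactSupport (p := 2) (p' := 6) (by norm_num)
      (by simp) (by simp; norm_num)
    exact this.trans (mul_le_mul_right (eLpNorm_fderiv_le (h n)) _)
  refine (Lp.eLpNorm_lim_le_liminf_eLpNorm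
    (fun n => (h n).contDiff.continuous.aestronglyMeasurable) _ hae).trans ?_
  have hlim' := ENNReal.Tendsto.const_mul (a := (eLpNormLESNormFDerivOfEqInnerConst
    (volume : Measure (Space 3)) 2 : ℝ≥0∞)) ((ENNReal.continuous_ofReal.tendsto _).comp hlim)
    (Or.inr ENNReal.coe_ne_top)
  rw [← hlim'.liminf_eq]
  exact liminf_le_liminf (Eventually.of_forall hb)

lemma exists_integral_pow_six_le : ∃ S : ℝ, 0 ≤ S ∧ ∀ u : H1r 3,
    Integrable (fun x => |fn (u : H1 3) x| ^ 6) ∧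
      ∫ x, |fn (u : H1 3) x| ^ 6 ≤ S * ‖u‖ ^ 6 := by
  obtain ⟨S, hS⟩ := exists_eLpNorm_six_le
  refine ⟨S ^ 6, by positivity, fun u => ?_⟩
  have hm : MemLp (fn (u : H1 3)) 6 :=
    ⟨Lp.aestronglyMeasurable _, (hS u).trans_lt (by finiteness)⟩
  have hi : Integrable (fun x => |fn (u : H1 3) x| ^ 6) :=
    hm.integrable_norm_pow (p := 6) (by norm_num)
  refine ⟨hi, ?_⟩
  have e1 := eLpNorm_nnreal_pow_eq_lintegral (f := fn (u : H1 3)) (μ := volume) (p := 6)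
    (by norm_num)
  have e2 : ENNReal.ofReal (∫ x, |fn (u : H1 3) x| ^ 6) = eLpNorm (fn (u : H1 3)) 6 ^ 6 := by
    rw [ofReal_integral_eq_lintegral_ofReal hi (ae_of_all _ fun x => by positivity)]
    have e3 : eLpNorm (fn (u : H1 3)) 6 ^ 6 = ∫⁻ x, ‖fn (u : H1 3) x‖ₑ ^ 6 := by
      have h6 : ((6 : NNReal) : ℝ) = ((6 : ℕ) : ℝ) := by norm_num
      rw [h6] at e1
      simp only [ENNReal.rpow_natCast] at e1
      exact e1
    rw [e3]
    congr 1
    ext x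
    rw [ENNReal.ofReal_pow (abs_nonneg _), ← Real.norm_eq_abs, ofReal_norm]
  rw [← ENNReal.ofReal_le_ofReal_iff (by positivity), e2]
  refine (ENNReal.pow_le_pow_left (hS u)).trans_eq ?_
  rw [mul_pow, ENNReal.ofReal_mul (by positivity), ENNReal.ofReal_pow (by positivity),
    ENNReal.ofReal_pow (by positivity), ENNReal.ofReal_coe_nnreal]

lemma BerestyckiLions.exists_abs_le_three (hf : BerestyckiLions 3 f) :
    ∃ C, 0 ≤ C ∧ ∀ t, |f t| ≤ C * (|t| + |t| ^ 5) := by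
  refine hf.exists_abs_le_mul (w := fun r => r + r ^ 5) (fun t => ?_) ?_
  · have : 0 ≤ |t| ^ 5 := by positivity
    linarith
  · have h := hf.growth_ge_three le_rfl
    have h1 := h.abs
    rw [abs_zero] at h1
    filter_upwards [h1.eventually_le_const one_pos, eventually_gt_atTop 0] with t ht ht0
    have e : ((3 : ℕ) + 2 : ℝ) / ((3 : ℕ) - 2) = (5 : ℕ) := by norm_num
    rw [e, Real.rpow_natCast, abs_div, abs_of_pos ht0, abs_of_pos (by positivity : 0 < t ^ 5),
      div_le_one (by positivity)] at ht
    linarith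

lemma mul_pow_five_le {a b : ℝ} (ha : 0 ≤ a) (hb : 0 ≤ b) : a * b ^ 5 ≤ a ^ 6 + b ^ 6 := by
  rcases le_total a b with h | h
  · have := mul_le_mul_of_nonneg_right h (by positivity : 0 ≤ b ^ 5)
    have : 0 ≤ a ^ 6 := by positivity
    linarith [show b * b ^ 5 = b ^ 6 by ring]
  · have := mul_le_mul_of_nonneg_left (pow_le_pow_left₀ hb h 5) ha
    have : 0 ≤ b ^ 6 := by positivity
    linarith [show a * a ^ 5 = a ^ 6 by ring]

/-- The critical growth |t| + |t|⁵ suffices: |v||u| is controlled in L², and |v||u|⁵ ≤ |v|⁶ + |u|⁶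
in L⁶. Normalising v is what allows these inhomogeneous bounds. -/
lemma exists_isWeight_three (hf : BerestyckiLions 3 f) (M : ℝ) :
    ∃ w K, IsWeight 3 M f w K := by
  obtain ⟨C, hC, hfC⟩ := hf.exists_abs_le_three
  obtain ⟨S, hS0, hS⟩ := exists_integral_pow_six_le
  refine ⟨fun t => C * (|t| + |t| ^ 5), C * ((1 + M ^ 2) + (S + S * M ^ 6)),
    isWeight_of_le (by fun_prop) (fun t => by positivity) ?_ fun u v hu hv => ?_⟩
  · refine abs_primitive_sub_le hf.continuous hC (w := fun r => r + r ^ 5)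
      (fun t => by positivity) (fun r hr s hs hrs => ?_) hfC
    exact add_le_add hrs (pow_le_pow_left₀ hr hrs 5)
  · have i1 := integrable_fn_sq (v : H1 3)
    have i2 := integrable_fn_sq (u : H1 3)
    obtain ⟨i3, j3⟩ := hS v
    obtain ⟨i4, j4⟩ := hS u
    have i12 : Integrable fun x => fn (v : H1 3) x ^ 2 + fn (u : H1 3) x ^ 2 := i1.add i2
    have i34 : Integrable fun x => |fn (v : H1 3) x| ^ 6 + |fn (u : H1 3) x| ^ 6 := i3.add i4
    refine ⟨fun x => C * ((fn (v : H1 3) x ^ 2 + fn (u : H1 3) x ^ 2) +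
      (|fn (v : H1 3) x| ^ 6 + |fn (u : H1 3) x| ^ 6)),
      (i12.add i34).const_mul C, ae_of_all _ fun x => ?_, ?_⟩
    · have h1 := mul_pow_five_le (abs_nonneg (fn (v : H1 3) x)) (abs_nonneg (fn (u : H1 3) x))
      have h2 : |fn (v : H1 3) x| * |fn (u : H1 3) x|
          ≤ fn (v : H1 3) x ^ 2 + fn (u : H1 3) x ^ 2 := by
        rw [← sq_abs (fn (v : H1 3) x), ← sq_abs (fn (u : H1 3) x)]
        nlinarith [sq_nonneg (|fn (v : H1 3) x| - |fn (u : H1 3) x|),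
          sq_nonneg |fn (v : H1 3) x|, sq_nonneg |fn (u : H1 3) x|]
      calc _ = C * (|fn (v : H1 3) x| * |fn (u : H1 3) x|
            + |fn (v : H1 3) x| * |fn (u : H1 3) x| ^ 5) := by ring
        _ ≤ _ := mul_le_mul_of_nonneg_left (add_le_add h2 h1) hC
    · rw [integral_const_mul, integral_add i12 i34, integral_add i1 i2, integral_add i3 i4]
      refine mul_le_mul_of_nonneg_left ?_ hC
      rw [hv, one_pow, mul_one] at j3
      have k1 := integral_fn_sq_le v hv.le
      have k2 := integral_fn_sq_le u hu
      have k4 : S * ‖u‖ ^ 6 ≤ S * M ^ 6 :=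
        mul_le_mul_of_nonneg_left (pow_le_pow_left₀ (norm_nonneg u) hu 6) hS0
      rw [one_pow] at k1
      linarith

end

/-! ### Dimension two: logarithmic bound for radial functions -/

section

variable {N : ℕ} {f : ℝ → ℝ}

/-- The logarithmic pointwise bound on the half line with weight `s ds`. -/
lemma sq_le_weighted_integral {ρ : ℝ → ℝ} (hρ : ContDiff ℝ 1 ρ) (hc : HasCompactSupport ρ)
    {r : ℝ} (hr : 0 < r) :
    ρ r ^ 2 ≤ 2 * (∫ s in Set.Ioi (0 : ℝ), s * (ρ s ^ 2 + deriv ρ s ^ 2)) *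
      (1 + max 0 (-Real.log r)) := by
  have hd : Continuous (deriv ρ) := hρ.continuous_deriv le_rfl
  have hcd : HasCompactSupport (deriv ρ) := hc.deriv
  have hcont : Continuous fun s : ℝ => s * (ρ s ^ 2 + deriv ρ s ^ 2) :=
    continuous_id.mul ((hρ.continuous.pow 2).add (hd.pow 2))
  have hcs : HasCompactSupport fun s : ℝ => s * (ρ s ^ 2 + deriv ρ s ^ 2) := by
    refine HasCompactSupport.mul_left (HasCompactSupport.add ?_ ?_)
    · exact hc.comp_left (g := fun t : ℝ => t ^ 2) (by simp)
    · exact hcd.comp_left (g := fun t : ℝ => t ^ 2) (by simp)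
  have hint : Integrable fun s : ℝ => s * (ρ s ^ 2 + deriv ρ s ^ 2) :=
    hcont.integrable_of_hasCompactSupport hcs
  set m : ℝ := ∫ s in Set.Ioi (0 : ℝ), s * (ρ s ^ 2 + deriv ρ s ^ 2)
  have hnn : ∀ s ∈ Set.Ioi (0 : ℝ), 0 ≤ s * (ρ s ^ 2 + deriv ρ s ^ 2) := fun s hs => by
    have : 0 < s := hs
    positivity
  have hm0 : 0 ≤ m := setIntegral_nonneg measurableSet_Ioi hnn
  -- Here ρ(t)² = -∫ 2ρρ' over (t, ∞), which is at most ∫ (ρ² + ρ'²), and the weight s is at least 1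
  -- there.
  have outer : ∀ t, 1 ≤ t → ρ t ^ 2 ≤ m := fun t ht => by
    have hρ2 : ContDiff ℝ 1 fun s => ρ s ^ 2 := hρ.pow 2
    have hc2 : HasCompactSupport fun s => ρ s ^ 2 :=
      hc.comp_left (g := fun t : ℝ => t ^ 2) (by simp)
    have e1 := hc2.integral_Ioi_deriv_eq hρ2 t
    have e2 : ∀ s, deriv (fun s => ρ s ^ 2) s = 2 * ρ s * deriv ρ s := fun s => by
      have h2 : HasDerivAt (fun s => ρ s ^ 2) _ s :=
        (hρ.differentiable one_ne_zero s).hasDerivAt.pow 2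
      simpa using h2.deriv
    have i1 : Integrable (deriv fun s => ρ s ^ 2) :=
      (hρ2.continuous_deriv le_rfl).integrable_of_hasCompactSupport hc2.deriv
    have e3 : ρ t ^ 2 = ∫ s in Set.Ioi t, -deriv (fun s => ρ s ^ 2) s := by
      rw [integral_neg, e1, neg_neg]
    rw [e3]
    refine (setIntegral_mono_on i1.neg.integrableOn hint.integrableOn measurableSet_Ioi
      fun s hs => ?_).trans (setIntegral_mono_set hint.integrableOn ?_ ?_)
    · have hs1 : 1 ≤ s := ht.trans (le_of_lt hs)
      rw [Pi.neg_apply, e2]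
      nlinarith [sq_nonneg (ρ s + deriv ρ s), sq_nonneg (ρ s), sq_nonneg (deriv ρ s)]
    · filter_upwards [ae_restrict_mem measurableSet_Ioi] with s hs using hnn s hs
    · exact (Set.Ioi_subset_Ioi (by linarith)).eventuallyLE
  rcases le_or_gt 1 r with h1 | h1
  · have := outer r h1
    have h2 : 0 ≤ max 0 (-Real.log r) := le_max_left _ _
    nlinarith [mul_nonneg hm0 h2]
  have hlog : 0 ≤ -Real.log r := by
    have := Real.log_nonpos hr.le h1.le
    linarith
  rw [max_eq_right hlog]
  set P : ℝ := ∫ s in r..1, s * deriv ρ s ^ 2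
  have hP : P ≤ m := by
    rw [show P = ∫ s in Set.Ioc r 1, s * deriv ρ s ^ 2 from
      intervalIntegral.integral_of_le h1.le]
    have i1 : IntegrableOn (fun s => s * deriv ρ s ^ 2) (Set.Ioc r 1) :=
      ((continuous_id.mul (hd.pow 2)).integrableOn_Icc).mono_set Set.Ioc_subset_Icc_self
    refine (setIntegral_mono_on i1 hint.integrableOn measurableSet_Ioc
      fun s hs => ?_).trans (setIntegral_mono_set hint.integrableOn ?_ ?_)
    · have : 0 < s := hr.trans hs.1
      exact mul_le_mul_of_nonneg_left (by nlinarith [sq_nonneg (ρ s)]) this.le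
    · filter_upwards [ae_restrict_mem measurableSet_Ioi] with s hs using hnn s hs
    · exact LE.le.eventuallyLE fun s hs => hr.trans hs.1
  have hI : ∫ s in r..1, deriv ρ s = ρ 1 - ρ r :=
    intervalIntegral.integral_deriv_eq_sub (fun s _ => hρ.differentiable one_ne_zero s)
      (hd.intervalIntegrable _ _)
  have hL : ∫ s in r..1, s⁻¹ = -Real.log r := by
    rw [integral_inv_of_pos hr one_pos, one_div, Real.log_inv]
  have iP : IntervalIntegrable (fun s => s * deriv ρ s ^ 2) volume r 1 :=
    (continuous_id.mul (hd.pow 2)).intervalIntegrable _ _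
  have iI : IntervalIntegrable (fun s => deriv ρ s) volume r 1 := hd.intervalIntegrable _ _
  have iL : IntervalIntegrable (fun s : ℝ => s⁻¹) volume r 1 := by
    refine intervalIntegral.intervalIntegrable_inv (f := fun s : ℝ => s) (fun s hs => ?_)
      continuousOn_id
    rw [Set.uIcc_of_le h1.le] at hs
    exact (hr.trans_le hs.1).ne'
  -- Cauchy-Schwarz for √s ρ' against 1/√s on [r, 1]: the quadratic is the integral of (x s ρ' - 1)²
  -- / s, and its discriminant gives (ρ(1) - ρ(r))² ≤ P · (-log r).
  have hquad : ∀ x : ℝ, 0 ≤ P * (x * x) + (-2 * (ρ 1 - ρ r)) * x + -Real.log r := fun x => by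
    have e : P * (x * x) + (-2 * (ρ 1 - ρ r)) * x + -Real.log r
        = ∫ s in r..1, (x ^ 2 * (s * deriv ρ s ^ 2) + (-2 * x) * deriv ρ s + s⁻¹) := by
      rw [intervalIntegral.integral_add ((iP.const_mul _).add (iI.const_mul _)) iL,
        intervalIntegral.integral_add (iP.const_mul _) (iI.const_mul _),
        intervalIntegral.integral_const_mul, intervalIntegral.integral_const_mul, hI, hL]
      ring
    rw [e]
    refine intervalIntegral.integral_nonneg h1.le fun s hs => ?_
    have hs0 : 0 < s := hr.trans_le hs.1
    have : x ^ 2 * (s * deriv ρ s ^ 2) + (-2 * x) * deriv ρ s + s⁻¹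
        = (x * s * deriv ρ s - 1) ^ 2 * s⁻¹ := by
      field_simp
      ring
    rw [this]
    positivity
  have hdisc := discrim_le_zero hquad
  rw [discrim] at hdisc
  have h3 : P * -Real.log r ≤ m * -Real.log r := mul_le_mul_of_nonneg_right hP hlog
  have h4 := outer 1 le_rfl
  -- The hint encodes ρ(r)² ≤ 2ρ(1)² + 2(ρ(1) - ρ(r))², the difference being (2ρ(1) - ρ(r))².
  nlinarith [sq_nonneg (2 * ρ 1 - ρ r)]

/-- Restricting φ to a full line through the origin gives a profile smooth on all of ℝ; at ‖x‖ its
derivative is the derivative of φ at x in the direction x/‖x‖. -/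
lemma IsRadialTest.exists_profile (hN : 0 < N) {φ : Space N → ℝ} (h : IsRadialTest φ) :
    ∃ ρ : ℝ → ℝ, ContDiff ℝ ∞ ρ ∧ HasCompactSupport ρ ∧ (∀ x, φ x = ρ ‖x‖) ∧
      ∀ x, x ≠ 0 → |deriv ρ ‖x‖| ≤ ‖gradient φ x‖ := by
  obtain ⟨e, he⟩ : ∃ e : Space N, ‖e‖ = 1 := ⟨EuclideanSpace.single ⟨0, hN⟩ 1, by simp⟩
  obtain ⟨ρ, hρ⟩ : ∃ ρ : ℝ → ℝ, ρ = fun r => φ (r • e) := ⟨_, rfl⟩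
  obtain ⟨R, hR0, hR⟩ := h.exists_support_radius
  refine ⟨ρ, ?_, ?_, fun x => ?_, fun x hx => ?_⟩
  · rw [hρ]
    exact h.contDiff.comp (contDiff_id.smul contDiff_const)
  · refine HasCompactSupport.intro (isCompact_Icc (a := -R) (b := R)) fun r hr => ?_
    rw [hρ]
    refine hR _ ?_
    rw [norm_smul, he, mul_one, Real.norm_eq_abs]
    by_contra! hlt
    exact hr ⟨by linarith [neg_abs_le r], by linarith [le_abs_self r]⟩
  · rw [hρ]
    exact h.radial _ _ (by rw [norm_smul, he, mul_one, norm_norm])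
  · have hx0 : 0 < ‖x‖ := norm_pos_iff.2 hx
    have hy : ‖‖x‖⁻¹ • x‖ = 1 := by
      rw [norm_smul, norm_inv, norm_norm, inv_mul_cancel₀ hx0.ne']
    have hρy : ρ = fun r => φ (r • ‖x‖⁻¹ • x) := by
      ext r
      rw [hρ]
      refine h.radial _ _ ?_
      rw [norm_smul, norm_smul r, he, hy]
    have hxx : ‖x‖ • ‖x‖⁻¹ • x = x := by
      rw [smul_smul, mul_inv_cancel₀ hx0.ne', one_smul]
    have hfd : HasFDerivAt φ (fderiv ℝ φ x) (‖x‖ • ‖x‖⁻¹ • x) := by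
      rw [hxx]
      exact (h.contDiff.differentiable (by simp) x).hasFDerivAt
    have hd : HasDerivAt ρ (fderiv ℝ φ x (‖x‖⁻¹ • x)) ‖x‖ := by
      rw [hρy]
      have h1 : HasDerivAt (fun r : ℝ => r • ‖x‖⁻¹ • x) (‖x‖⁻¹ • x) ‖x‖ := by
        simpa using (hasDerivAt_id ‖x‖).smul_const (‖x‖⁻¹ • x)
      exact hfd.comp_hasDerivAt ‖x‖ h1
    rw [hd.deriv, norm_gradient, ← Real.norm_eq_abs]
    have := (fderiv ℝ φ x).le_opNorm (‖x‖⁻¹ • x)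
    rwa [hy, mul_one] at this

lemma ae_ne_zero_two : ∀ᵐ x : Space 2, x ≠ 0 := by
  simp [ae_iff, measure_singleton]

lemma volume_real_unitBall_pos : 0 < volume.real (Metric.ball (0 : Space N) 1) :=
  ENNReal.toReal_pos (Metric.measure_ball_pos _ _ one_pos).ne' measure_ball_lt_top.ne

lemma integral_radial_two (g : ℝ → ℝ) : ∫ x : Space 2, g ‖x‖ =
    2 * volume.real (Metric.ball (0 : Space 2) 1) * ∫ s in Set.Ioi (0 : ℝ), s * g s := by
  rw [integral_fun_norm_addHaar volume g]
  simp [mul_assoc]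

lemma IsRadialTest.integral_profile_le {φ : Space 2 → ℝ} (h : IsRadialTest φ) {ρ : ℝ → ℝ}
    (hρ : ContDiff ℝ ∞ ρ) (hρc : HasCompactSupport ρ) (hφρ : ∀ x, φ x = ρ ‖x‖)
    (hderiv : ∀ x, x ≠ 0 → |deriv ρ ‖x‖| ≤ ‖gradient φ x‖) :
    2 * volume.real (Metric.ball (0 : Space 2) 1) *
      ∫ s in Set.Ioi (0 : ℝ), s * (ρ s ^ 2 + deriv ρ s ^ 2) ≤ ‖h.toH1‖ ^ 2 := by
  have hd1 : Continuous (deriv ρ) := hρ.continuous_deriv (by simp)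
  have key : ∀ g : ℝ → ℝ, Continuous g → HasCompactSupport g →
      IntegrableOn (fun s : ℝ => s * g s ^ 2) (Set.Ioi 0) := by
    intro g hg hgc
    have h1 : Continuous fun s : ℝ => s * g s ^ 2 := by fun_prop
    have h2 : HasCompactSupport fun s : ℝ => g s ^ 2 :=
      hgc.comp_left (g := fun t : ℝ => t ^ 2) (by simp)
    have h3 : HasCompactSupport fun s : ℝ => s * g s ^ 2 := h2.mul_left
    exact (h1.integrable_of_hasCompactSupport h3).integrableOn
  have e1 : ∫ x : Space 2, ρ ‖x‖ ^ 2 = ∫ x, ‖fn h.toH1 x‖ ^ 2 := by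
    refine integral_congr_ae ?_
    filter_upwards [h.fn_toH1] with x hx
    rw [hx, hφρ, Real.norm_eq_abs, sq_abs]
  have e2 : ∫ x : Space 2, deriv ρ ‖x‖ ^ 2 ≤ ∫ x, ‖weakGrad h.toH1 x‖ ^ 2 := by
    refine integral_mono_of_nonneg (ae_of_all _ fun _ => sq_nonneg _)
      ((Lp.memLp (weakGrad h.toH1)).integrable_norm_pow two_ne_zero) ?_
    filter_upwards [h.weakGrad_toH1, ae_ne_zero_two] with x hx hx0
    rw [hx, ← sq_abs (deriv ρ ‖x‖)]
    exact pow_le_pow_left₀ (abs_nonneg _) (hderiv x hx0) 2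
  simp_rw [mul_add]
  rw [integral_add (key ρ hρ.continuous hρc) (key _ hd1 hρc.deriv), mul_add, norm_H1_sq,
    ← integral_radial_two (fun s => ρ s ^ 2), ← integral_radial_two (fun s => deriv ρ s ^ 2)]
  exact add_le_add e1.le e2

lemma IsRadialTest.sq_le_log {φ : Space 2 → ℝ} (h : IsRadialTest φ) {x : Space 2} (hx : x ≠ 0) :
    φ x ^ 2 ≤ 1 / volume.real (Metric.ball (0 : Space 2) 1) * ‖h.toH1‖ ^ 2 *
      (1 + max 0 (-Real.log ‖x‖)) := by
  obtain ⟨ρ, hρ, hρc, hφρ, hderiv⟩ := h.exists_profile two_pos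
  have hm := h.integral_profile_le hρ hρc hφρ hderiv
  have h1 := sq_le_weighted_integral (hρ.of_le (by simp)) hρc (norm_pos_iff.2 hx)
  rw [← hφρ] at h1
  refine h1.trans (mul_le_mul_of_nonneg_right ?_ (by positivity))
  rw [div_mul_eq_mul_div, le_div_iff₀ volume_real_unitBall_pos]
  linarith

lemma exists_sq_le_log : ∃ κ : ℝ, 0 < κ ∧ ∀ u : H1r 2,
    ∀ᵐ x, fn (u : H1 2) x ^ 2 ≤ κ * ‖u‖ ^ 2 * (1 + max 0 (-Real.log ‖x‖)) := by
  refine ⟨1 / volume.real (Metric.ball (0 : Space 2) 1),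
    one_div_pos.2 volume_real_unitBall_pos, fun u => ?_⟩
  obtain ⟨φ, h, hlim, hae⟩ := exists_seq_isRadialTest u
  filter_upwards [hae, ae_ne_zero_two] with x hx hx0
  exact le_of_tendsto_of_tendsto' (hx.pow 2)
    (((hlim.pow 2).const_mul _).mul_const _) fun n => (h n).sq_le_log hx0

lemma integrableOn_inv_norm :
    IntegrableOn (fun x : Space 2 => ‖x‖⁻¹) (Metric.ball 0 1) := by
  rw [integrableOn_fun_norm_addHaar (volume : Measure (Space 2)) (f := fun r : ℝ => r⁻¹)]
  refine (integrableOn_const (C := (1 : ℝ)) (by simp)).congr_fun (fun y hy => ?_)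
    measurableSet_Ioo
  have : y ≠ 0 := hy.1.ne'
  simp [this]

/-- The extra factor |t| is free for |t| ≥ 1, and it makes the weight of u square integrable where u
is small. -/
lemma BerestyckiLions.exists_abs_le_two (hf : BerestyckiLions 2 f) {α : ℝ} (hα : 0 < α) :
    ∃ C, 0 ≤ C ∧ ∀ t, |f t| ≤ C * (|t| * Real.exp (α * |t| ^ 2)) := by
  refine hf.exists_abs_le_mul (w := fun r => r * Real.exp (α * r ^ 2)) (fun t => ?_) ?_
  · exact le_mul_of_one_le_right (abs_nonneg t) (Real.one_le_exp (by positivity))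
  · have h1 := (hf.growth_two rfl α hα).abs
    rw [abs_zero] at h1
    filter_upwards [h1.eventually_le_const one_pos, eventually_ge_atTop 1] with t ht ht1
    rw [abs_div, abs_of_pos (Real.exp_pos _), div_le_one (Real.exp_pos _)] at ht
    exact ht.trans (le_mul_of_one_le_left (Real.exp_pos _).le ht1)

lemma mul_exp_le {s κ α Λ : ℝ} (hα : 0 ≤ α) (hακ : α * κ ≤ 1 / 4) (hΛ : 0 ≤ Λ)
    (hκ : 0 ≤ κ) (hs : s ≤ κ * (1 + Λ)) :
    s * Real.exp (2 * (α * s)) ≤ 2 * κ * Real.exp 1 * Real.exp Λ := by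
  have h1 : 2 * (α * s) ≤ (1 + Λ) / 2 := by
    have h2 := mul_le_mul_of_nonneg_left hs hα
    have h3 := mul_le_mul_of_nonneg_right hακ (by linarith : 0 ≤ 1 + Λ)
    linarith
  have h4 : (1 + Λ) / 2 ≤ Real.exp ((1 + Λ) / 2) := by
    linarith [Real.add_one_le_exp ((1 + Λ) / 2)]
  calc s * Real.exp (2 * (α * s)) ≤ (κ * (1 + Λ)) * Real.exp ((1 + Λ) / 2) :=
        mul_le_mul hs (Real.exp_le_exp.2 h1) (Real.exp_pos _).le (by positivity)
    _ = 2 * κ * (((1 + Λ) / 2) * Real.exp ((1 + Λ) / 2)) := by ring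
    _ ≤ 2 * κ * (Real.exp ((1 + Λ) / 2) * Real.exp ((1 + Λ) / 2)) :=
        mul_le_mul_of_nonneg_left
          (mul_le_mul_of_nonneg_right h4 (Real.exp_pos _).le) (by positivity)
    _ = 2 * κ * Real.exp 1 * Real.exp Λ := by
        rw [← Real.exp_add, mul_assoc (2 * κ), ← Real.exp_add]
        ring_nf

lemma exists_isWeight_two (hf : BerestyckiLions 2 f) {M : ℝ} (hM : 0 < M) :
    ∃ w K, IsWeight 2 M f w K := by
  obtain ⟨κ, hκ, hlog⟩ := exists_sq_le_log
  obtain ⟨D, hD⟩ : ∃ D, D = κ * M ^ 2 := ⟨_, rfl⟩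
  have hD0 : 0 < D := by rw [hD]; positivity
  -- The growth condition holds for every α > 0, so α may depend on the radius M. With α D = 1/4 the
  -- exponential costs about |x|^(-1/2) near the origin; absorbing the factor u² as well leaves
  -- |x|⁻¹, which is integrable on the unit disc.
  obtain ⟨α, hα⟩ : ∃ α, α = 1 / (4 * D) := ⟨_, rfl⟩
  have hα0 : 0 < α := by rw [hα]; positivity
  have hαD : α * D = 1 / 4 := by rw [hα]; field_simp
  obtain ⟨C, hC, hfC⟩ := hf.exists_abs_le_two hα0
  obtain ⟨J, hJ⟩ : ∃ J : Space 2 → ℝ,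
      J = (Metric.ball 0 1).indicator fun x => ‖x‖⁻¹ := ⟨_, rfl⟩
  have iJ : Integrable J := by
    rw [hJ, integrable_indicator_iff measurableSet_ball]
    exact integrableOn_inv_norm
  have hJ0 : ∀ x, 0 ≤ J x := fun x => by
    rw [hJ]
    exact Set.indicator_nonneg (fun _ _ => by positivity) _
  have hbound : ∀ u : H1r 2, ‖u‖ ≤ M → ∀ᵐ x, fn (u : H1 2) x ^ 2 *
      Real.exp (2 * (α * fn (u : H1 2) x ^ 2))
        ≤ Real.exp 1 * fn (u : H1 2) x ^ 2 + 2 * D * Real.exp 1 * J x := fun u hu => by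
    filter_upwards [hlog u, ae_ne_zero_two] with x hx hx0
    have hxp : 0 < ‖x‖ := norm_pos_iff.2 hx0
    have hx1 : fn (u : H1 2) x ^ 2 ≤ D * (1 + max 0 (-Real.log ‖x‖)) := by
      refine hx.trans (mul_le_mul_of_nonneg_right ?_ (by positivity))
      rw [hD]
      exact mul_le_mul_of_nonneg_left (pow_le_pow_left₀ (norm_nonneg u) hu 2) hκ.le
    have hs0 : 0 ≤ fn (u : H1 2) x ^ 2 := by positivity
    rcases lt_or_ge ‖x‖ 1 with h1 | h1
    · have hl : 0 ≤ -Real.log ‖x‖ := by linarith [Real.log_nonpos hxp.le h1.le]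
      rw [max_eq_right hl] at hx1
      have h2 := mul_exp_le hα0.le hαD.le hl hD0.le hx1
      rw [Real.exp_neg, Real.exp_log hxp] at h2
      have h3 : J x = ‖x‖⁻¹ := by
        rw [hJ, Set.indicator_of_mem (by simpa using h1)]
      rw [h3]
      have : 0 ≤ Real.exp 1 * fn (u : H1 2) x ^ 2 := by positivity
      linarith
    · have hl : -Real.log ‖x‖ ≤ 0 := by linarith [Real.log_nonneg h1]
      rw [max_eq_left hl, add_zero, mul_one] at hx1
      have h2 := mul_le_mul_of_nonneg_left hx1 hα0.le
      have h3 : Real.exp (2 * (α * fn (u : H1 2) x ^ 2)) ≤ Real.exp 1 :=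
        Real.exp_le_exp.2 (by linarith)
      have h4 := mul_le_mul_of_nonneg_left h3 hs0
      have : 0 ≤ 2 * D * Real.exp 1 * J x := mul_nonneg (by positivity) (hJ0 x)
      linarith
  refine ⟨fun t => C * (|t| * Real.exp (α * |t| ^ 2)),
    C * (1 + (Real.exp 1 * M ^ 2 + 2 * D * Real.exp 1 * ∫ x, J x)),
    isWeight_of_le (by fun_prop) (fun t => by positivity) ?_ fun u v hu hv => ?_⟩
  · refine abs_primitive_sub_le hf.continuous hC (w := fun r => r * Real.exp (α * r ^ 2))
      (fun t => by positivity) (fun r hr s hs hrs => ?_) hfC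
    have hr0 : 0 ≤ r := hr
    dsimp only
    gcongr
  · have i1 := integrable_fn_sq (v : H1 2)
    have i2 := (integrable_fn_sq (u : H1 2)).const_mul (Real.exp 1)
    have i3 := iJ.const_mul (2 * D * Real.exp 1)
    have i23 : Integrable fun x => Real.exp 1 * fn (u : H1 2) x ^ 2 + 2 * D * Real.exp 1 * J x :=
      i2.add i3
    refine ⟨fun x => C * (fn (v : H1 2) x ^ 2 +
      (Real.exp 1 * fn (u : H1 2) x ^ 2 + 2 * D * Real.exp 1 * J x)),
      (i1.add i23).const_mul C, ?_, ?_⟩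
    · filter_upwards [hbound u hu] with x hx
      have h1 : |fn (v : H1 2) x| * (|fn (u : H1 2) x| * Real.exp (α * |fn (u : H1 2) x| ^ 2))
          ≤ fn (v : H1 2) x ^ 2
            + fn (u : H1 2) x ^ 2 * Real.exp (2 * (α * fn (u : H1 2) x ^ 2)) := by
        have e : Real.exp (2 * (α * fn (u : H1 2) x ^ 2))
            = Real.exp (α * |fn (u : H1 2) x| ^ 2) ^ 2 := by
          rw [sq_abs, ← Real.exp_nat_mul]
          norm_num
        rw [e, ← mul_pow, ← sq_abs (fn (v : H1 2) x), ← sq_abs (fn (u : H1 2) x * _), abs_mul,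
          abs_of_pos (Real.exp_pos _)]
        set p := |fn (v : H1 2) x|
        set q := |fn (u : H1 2) x| * Real.exp (α * |fn (u : H1 2) x| ^ 2)
        nlinarith [sq_nonneg (p - q), sq_nonneg p, sq_nonneg q]
      calc _ = C * (|fn (v : H1 2) x| *
            (|fn (u : H1 2) x| * Real.exp (α * |fn (u : H1 2) x| ^ 2))) := by ring
        _ ≤ _ := mul_le_mul_of_nonneg_left (h1.trans (by linarith)) hC
    · rw [integral_const_mul, integral_add i1 i23, integral_add i2 i3, integral_const_mul,
        integral_const_mul]
      refine mul_le_mul_of_nonneg_left ?_ hC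
      have k1 := integral_fn_sq_le v hv.le
      have k2 := mul_le_mul_of_nonneg_left (integral_fn_sq_le u hu) (Real.exp_pos 1).le
      rw [one_pow] at k1
      linarith

end

/-! ### Openness of the sublevel and reduction to test functions -/

section

variable {N : ℕ} {a b : ℝ} {f : ℝ → ℝ}

lemma BerestyckiLions.isOpen_negativeSublevel (hN : N = 2 ∨ N = 3) (hf : BerestyckiLions N f)
    (a b : ℝ) : IsOpen (negativeSublevel N a b f) := by
  refine Kirchhoff.isOpen_negativeSublevel hf.continuous (fun M hM => ?_) a b
  rcases hN with rfl | rfl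
  · exact exists_isWeight_two hf hM
  · exact exists_isWeight_three hf M

/-- A ball around u inside the sublevel contains a radial test function by density, and balls are
convex. -/
lemma exists_isRadialTest_joinedIn (ho : IsOpen (negativeSublevel N a b f)) {u : H1r N}
    (hu : u ∈ negativeSublevel N a b f) : ∃ (φ : Space N → ℝ) (h : IsRadialTest φ),
      h.toH1r ∈ negativeSublevel N a b f ∧ JoinedIn (negativeSublevel N a b f) u h.toH1r := by
  obtain ⟨r, hr, hball⟩ := Metric.isOpen_iff.1 ho u hu
  obtain ⟨φ, h, hlt⟩ := exists_isRadialTest_norm_sub_lt u hr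
  have hmem : h.toH1r ∈ Metric.ball u r := by
    rw [Metric.mem_ball', dist_eq_norm]
    exact hlt
  refine ⟨φ, h, hball hmem, JoinedIn.mono ?_ hball⟩
  exact ((convex_ball u r).isPathConnected ⟨u, Metric.mem_ball_self hr⟩).joinedIn _
    (Metric.mem_ball_self hr) _ hmem

end

end Kirchhoff

end

theorem theoremB1 (a b : ℝ) (ha : 0 ≤ a) (hb : 0 < b) (N : ℕ) (hN : N = 2 ∨ N = 3)
    (f : ℝ → ℝ) (hf : Kirchhoff.BerestyckiLions N f) :
    IsPathConnected (Kirchhoff.negativeSublevel N a b f) := by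
  have ho := hf.isOpen_negativeSublevel hN a b
  obtain ⟨ζ, hζ0, hζ⟩ := hf.exists_pos_ge_two (by omega)
  refine isPathConnected_iff.2
    ⟨Kirchhoff.nonempty_negativeSublevel ha hb hN hf.continuous hζ hζ0, fun u hu v hv => ?_⟩
  obtain ⟨φ, hφ, hφ0, huφ⟩ := Kirchhoff.exists_isRadialTest_joinedIn ho hu
  obtain ⟨ψ, hψ, hψ0, hvψ⟩ := Kirchhoff.exists_isRadialTest_joinedIn ho hv
  exact (huφ.trans (Kirchhoff.joinedIn_of_isRadialTest ha hb hN hf.continuous hζ hζ0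
    hφ hψ hφ0 hψ0)).trans hvψ.symm
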